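/- Let $\mathbb K=\mathbb R$ or $\mathbb C$, let $k\ge 2$, and let $\varphi_k:(\mathbb K^{2k-2},0)\to(\mathbb K^{2k-1},0)$ be the minimal cross cap mapping of multiplicity $k$, \[ \varphi_k(u_1,\dots,u_{k-2},v_1,\dots,v_{k-1},y)=\Bigl(u_1,\dots,u_{k-2},v_1,\dots,v_{k-1},\;y^k+\sum_{i=1}^{k-2}u_iy^i,\;\sum_{i=1}^{k-1}v_iy^i\Bigr), \] with target coordinates $U_1,\dots,U_{k-2},V_1,\dots,V_{k-1},W_1,W_2$. A vector field $\xi$ on $(\mathbb K^{2k-1},0)$ is liftable over $\varphi_k$ if there is a smooth (holomorphic when $\mathbb K=\mathbb C$) vector field $\eta$ on a neighbourhood of $0$ in $\mathbb K^{2k-2}$ such that $d\varphi_k\circ\eta=\xi\circ\varphi_k$ there. Put $U_{k-1}=V_k=0$, $U_k=1$, and $U_r=V_r=0$ for $r\le 0$ and for $r>k$. Write a vector field on $\mathbb K^{2k-1}$ as $(A_1,\dots,A_{k-2},B_1,\dots,B_{k-1},C_1,C_2)$, with components in the order of the coordinates above. Let $\xi_e$ be the Euler vector field, with $A_i=(k-i)U_i$,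 $B_i=(k-i)V_i$, $C_1=kW_1$, $C_2=kW_2$. For $1\le j\le k-1$ let $\xi^1_j,\xi^2_j,\xi^3_j$ be the vector fields with the following components, where $1\le i\le k-2$ in $A_i$ and $1\le i\le k-1$ in $B_i$. For $\xi^1_j$: \begin{align*} A_i&=(k-i)(k-j)U_iU_j,\\ B_i&=k\sum_{r=1}^{i-1}U_{i+j-r}V_r-k\sum_{r=1}^{i}U_rV_{i+j-r}-(i-1)(k-j)U_jV_i+kV_{i+j}W_1-kU_{i+j}W_2,\\ C_1&=k(k-j)U_jW_1,\\ C_2&=-kV_jW_1+(k-j)U_jW_2. \end{align*} For $\xi^2_j$: \begin{align*} A_i&=-k(k+i-j+1)U_{k+i-j+1}W_1+k\sum_{r=1}^i(k+i-j-2r+1)U_rU_{k+i-j-r+1}-j(i+1)U_{i+1}U_{k-j},\\ B_i&=-k(k+i-j+1)V_{k+i-j+1}W_1+k\sum_{r=1}^i(k+i-j-r+1)U_rV_{k+i-j-r+1}\\ &\qquad-k\sum_{r=1}^irU_{k+i-j-r+1}V_r-j(i+1)U_{k-j}V_{i+1},\\ C_1&=k(k-j+1)U_{k-j+1}W_1+jU_1U_{k-j},\\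 C_2&=k(k-j+1)V_{k-j+1}W_1+jV_1U_{k-j}. \end{align*} For $\xi^3_j$: \begin{align*} A_i&=-k(k+i-j+1)U_{k+i-j+1}W_2+k\sum_{r=1}^i(k+i-j-r+1)U_{k+i-j-r+1}V_r\\ &\qquad-k\sum_{r=1}^irU_rV_{k+i-j-r+1}-k(i+1)U_{i+1}V_{k-j},\\ B_i&=-k(k+i-j+1)V_{k+i-j+1}W_2+k\sum_{r=1}^i(k+i-j-2r+1)V_rV_{k+i-j-r+1}-k(i+1)V_{i+1}V_{k-j},\\ C_1&=k(k-j+1)U_{k-j+1}W_2+kU_1V_{k-j},\\ C_2&=k(k-j+1)V_{k-j+1}W_2+kV_1V_{k-j}. \end{align*} Let $\xi$ be a vector field on $\mathbb K^{2k-1}$ that is liftable over $\varphi_k$ and whose components are polynomials. Then there exist polynomials $g_e$ and $g_{i,j}$ ($1\le i\le 3$, $1\le j\le k-1$) in the target coordinates, with coefficients in $\mathbb K$, such that \[ \xi=g_e\,\xi_e+\sum_{i=1}^{3}\sum_{j=1}^{k-1}g_{i,j}\,\xi^i_j . \] -/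

import Mathlib

open scoped ContDiff

noncomputable section

namespace CrossCap

/-- A vector field `ξ` near the origin of `𝕜^τ` is liftable over (the germ at `0` of)
`f : 𝕜^σ → 𝕜^τ` if there is a smooth vector field `η` on an open neighbourhood of the origin of
`𝕜^σ` with `df ∘ η = ξ ∘ f` there. For `𝕜 = ℂ`, smooth means holomorphic. -/
def Liftable {𝕜 : Type*} [RCLike 𝕜] {σ τ : Type*} [Fintype σ] [Fintype τ]
    (f : (σ → 𝕜) → (τ → 𝕜)) (ξ : (τ → 𝕜) → (τ → 𝕜)) : Prop :=
  ∃ (N : Set (σ → 𝕜)) (η : (σ → 𝕜) → (σ → 𝕜)), IsOpen N ∧ 0 ∈ N ∧ ContDiffOn 𝕜 ∞ η N ∧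
    ∀ x ∈ N, fderiv 𝕜 f x (η x) = ξ (f x)

/-- Labels of the source coordinates `u_1, …, u_{k-2}`, `v_1, …, v_{k-1}`, `y`.
The element `i` of `Fin (k - 2)` or `Fin (k - 1)` labels the coordinate of index `i + 1`. -/
abbrev Src (k : ℕ) : Type := Fin (k - 2) ⊕ Fin (k - 1) ⊕ Unit

/-- Labels of the target coordinates `U_1, …, U_{k-2}`, `V_1, …, V_{k-1}`, `W_1, W_2`.
The element `i` of `Fin (k - 2)` or `Fin (k - 1)` labels the coordinate of index `i + 1`;
the elements `0` and `1` of `Fin 2` label `W_1` and `W_2`. -/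
abbrev Tgt (k : ℕ) : Type := Fin (k - 2) ⊕ Fin (k - 1) ⊕ Fin 2

/-- Polynomial functions on the target. -/
abbrev Poly (k : ℕ) (𝕜 : Type*) [RCLike 𝕜] : Type _ := MvPolynomial (Tgt k) 𝕜

/-- Vector fields with polynomial components on the target. -/
abbrev PolyField (k : ℕ) (𝕜 : Type*) [RCLike 𝕜] : Type _ := Tgt k → Poly k 𝕜

/-- The vector field, as a map, with the given polynomial components. -/
def PolyField.toFun {k : ℕ} {𝕜 : Type*} [RCLike 𝕜] (ξ : PolyField k 𝕜) :
    (Tgt k → 𝕜) → (Tgt k → 𝕜) :=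
  fun p t => MvPolynomial.eval p (ξ t)

/-- The vector field with components `A_1, …, A_{k-2}`, `B_1, …, B_{k-1}`, `C_1`, `C_2`. -/
def mkField {k : ℕ} {𝕜 : Type*} [RCLike 𝕜] (A B : ℕ → Poly k 𝕜) (C₁ C₂ : Poly k 𝕜) :
    PolyField k 𝕜
  | .inl i => A (i + 1)
  | .inr (.inl i) => B (i + 1)
  | .inr (.inr 0) => C₁
  | .inr (.inr 1) => C₂

section

variable (k : ℕ) (𝕜 : Type*) [RCLike 𝕜]

/-- The minimal cross cap mapping of multiplicity `k`. -/
def crossCap (x : Src k → 𝕜) : Tgt k → 𝕜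
  | .inl i => x (.inl i)
  | .inr (.inl i) => x (.inr (.inl i))
  | .inr (.inr 0) => x (.inr (.inr ())) ^ k +
      ∑ i : Fin (k - 2), x (.inl i) * x (.inr (.inr ())) ^ ((i : ℕ) + 1)
  | .inr (.inr 1) =>
      ∑ i : Fin (k - 1), x (.inr (.inl i)) * x (.inr (.inr ())) ^ ((i : ℕ) + 1)

/-- `U_r`, with the conventions `U_{k-1} = 0`, `U_k = 1`, `U_r = 0` for `r ≤ 0` and `r > k`. -/
def U (r : ℕ) : Poly k 𝕜 :=
  if h : 1 ≤ r ∧ r ≤ k - 2 then MvPolynomial.X (.inl ⟨r - 1, by omega⟩)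
  else if r = k then 1 else 0

/-- `V_r`, with the conventions `V_k = 0`, `V_r = 0` for `r ≤ 0` and `r > k`. -/
def V (r : ℕ) : Poly k 𝕜 :=
  if h : 1 ≤ r ∧ r ≤ k - 1 then MvPolynomial.X (.inr (.inl ⟨r - 1, by omega⟩)) else 0

/-- The coordinate `W_1`. -/
def W₁ : Poly k 𝕜 := MvPolynomial.X (.inr (.inr 0))

/-- The coordinate `W_2`. -/
def W₂ : Poly k 𝕜 := MvPolynomial.X (.inr (.inr 1))

/-- The Euler vector field of the cross cap mapping. -/
def eulerField : PolyField k 𝕜 :=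
  mkField (fun i => ((k : Poly k 𝕜) - i) * U k 𝕜 i) (fun i => ((k : Poly k 𝕜) - i) * V k 𝕜 i)
    (k * W₁ k 𝕜) (k * W₂ k 𝕜)

/-! In the three families `1 ≤ j ≤ k - 1`. The numerical coefficients are computed in the
polynomial ring; the subtractions in the subscripts are those of natural numbers, and there the
result is never negative because `j < k` and `r ≤ i`. -/

/-- The first family `ξ^1_j`. -/
def field₁ (j : ℕ) : PolyField k 𝕜 :=
  mkField
    (fun i => ((k : Poly k 𝕜) - i) * (k - j) * U k 𝕜 i * U k 𝕜 j)
    (fun i => k * ∑ r ∈ Finset.Icc 1 (i - 1), U k 𝕜 (i + j - r) * V k 𝕜 r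
      - k * ∑ r ∈ Finset.Icc 1 i, U k 𝕜 r * V k 𝕜 (i + j - r)
      - ((i : Poly k 𝕜) - 1) * (k - j) * U k 𝕜 j * V k 𝕜 i
      + k * V k 𝕜 (i + j) * W₁ k 𝕜 - k * U k 𝕜 (i + j) * W₂ k 𝕜)
    (k * ((k : Poly k 𝕜) - j) * U k 𝕜 j * W₁ k 𝕜)
    (-k * V k 𝕜 j * W₁ k 𝕜 + ((k : Poly k 𝕜) - j) * U k 𝕜 j * W₂ k 𝕜)

/-- The second family `ξ^2_j`. -/
def field₂ (j : ℕ) : PolyField k 𝕜 :=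
  mkField
    (fun i => -k * ((k : Poly k 𝕜) + i - j + 1) * U k 𝕜 (k + i - j + 1) * W₁ k 𝕜
      + k * ∑ r ∈ Finset.Icc 1 i,
          ((k : Poly k 𝕜) + i - j - 2 * r + 1) * U k 𝕜 r * U k 𝕜 (k + i - j - r + 1)
      - j * ((i : Poly k 𝕜) + 1) * U k 𝕜 (i + 1) * U k 𝕜 (k - j))
    (fun i => -k * ((k : Poly k 𝕜) + i - j + 1) * V k 𝕜 (k + i - j + 1) * W₁ k 𝕜
      + k * ∑ r ∈ Finset.Icc 1 i,
          ((k : Poly k 𝕜) + i - j - r + 1) * U k 𝕜 r * V k 𝕜 (k + i - j - r + 1)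
      - k * ∑ r ∈ Finset.Icc 1 i, (r : Poly k 𝕜) * U k 𝕜 (k + i - j - r + 1) * V k 𝕜 r
      - j * ((i : Poly k 𝕜) + 1) * U k 𝕜 (k - j) * V k 𝕜 (i + 1))
    (k * ((k : Poly k 𝕜) - j + 1) * U k 𝕜 (k - j + 1) * W₁ k 𝕜 + j * U k 𝕜 1 * U k 𝕜 (k - j))
    (k * ((k : Poly k 𝕜) - j + 1) * V k 𝕜 (k - j + 1) * W₁ k 𝕜 + j * V k 𝕜 1 * U k 𝕜 (k - j))

/-- The third family `ξ^3_j`. -/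
def field₃ (j : ℕ) : PolyField k 𝕜 :=
  mkField
    (fun i => -k * ((k : Poly k 𝕜) + i - j + 1) * U k 𝕜 (k + i - j + 1) * W₂ k 𝕜
      + k * ∑ r ∈ Finset.Icc 1 i,
          ((k : Poly k 𝕜) + i - j - r + 1) * U k 𝕜 (k + i - j - r + 1) * V k 𝕜 r
      - k * ∑ r ∈ Finset.Icc 1 i, (r : Poly k 𝕜) * U k 𝕜 r * V k 𝕜 (k + i - j - r + 1)
      - k * ((i : Poly k 𝕜) + 1) * U k 𝕜 (i + 1) * V k 𝕜 (k - j))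
    (fun i => -k * ((k : Poly k 𝕜) + i - j + 1) * V k 𝕜 (k + i - j + 1) * W₂ k 𝕜
      + k * ∑ r ∈ Finset.Icc 1 i,
          ((k : Poly k 𝕜) + i - j - 2 * r + 1) * V k 𝕜 r * V k 𝕜 (k + i - j - r + 1)
      - k * ((i : Poly k 𝕜) + 1) * V k 𝕜 (i + 1) * V k 𝕜 (k - j))
    (k * ((k : Poly k 𝕜) - j + 1) * U k 𝕜 (k - j + 1) * W₂ k 𝕜 + k * U k 𝕜 1 * V k 𝕜 (k - j))
    (k * ((k : Poly k 𝕜) - j + 1) * V k 𝕜 (k - j + 1) * W₂ k 𝕜 + k * V k 𝕜 1 * V k 𝕜 (k - j))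

/-- The fields `ξ^f_j`; the elements `0, 1, 2` of `Fin 3` label the first, second and third
family. -/
def family (f : Fin 3) (j : ℕ) : PolyField k 𝕜 :=
  ![field₁ k 𝕜 j, field₂ k 𝕜 j, field₃ k 𝕜 j] f

end

end CrossCap

end

/-! Put `P = y^k + ∑ u_i y^i` and `Q = ∑ v_i y^i`. The `u`- and `v`-components of a lift are forced,
so a vector field lifts if and only if there is a function `h`, the `y`-component of the lift, with
`(C₁ - ∑ A_i y^i) ∘ φ = P' h` and `(C₂ - ∑ B_i y^i) ∘ φ = Q' h`. If the field is polynomial, then so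
is `h`: the left-hand side of the first equation vanishes on the zeros of `P'` near the origin, and
`P'` is, up to a nonzero constant, a coordinate function.

Multiples of the families `ξ^2` and `ξ^3` remove `W₁` and `W₂` from `C₁ - ∑ A_i y^i`. It is then
unchanged by substituting `φ`, divisible by `P'` and of smaller degree in `y`; hence it is zero, and
so is `h`. Next, `k ξ_e - ξ^2_1` and `ξ^1_j - (k - j) U_j ξ_e` leave `C₁ - ∑ A_i y^i` equal to zero
and remove `W₂` from `C₂ - ∑ B_i y^i`. That polynomial is sent to zero by `W₁ ↦ P`, and it is zero
because `1, y, …, y^(k-1)` are linearly independent over the polynomials in `u_i`, `v_i` and `P`. -/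

open Polynomial Filter Topology

noncomputable section

namespace CrossCap

section ShiftedPolynomials

variable {S : Type*} [CommRing S]

lemma coeff_divByMonic_X_pow (f : S[X]) (m n : ℕ) : (f /ₘ X ^ m).coeff n = f.coeff (m + n) := by
  nontriviality S
  have hlow : (f %ₘ X ^ m).coeff (m + n) = 0 :=
    coeff_eq_zero_of_degree_lt <| (degree_modByMonic_lt f (monic_X_pow m)).trans_le <| by
      rw [degree_X_pow]
      exact_mod_cast m.le_add_right n
  conv_rhs => rw [← modByMonic_add_div f (X ^ m), coeff_add, hlow, zero_add, add_comm m,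
    coeff_X_pow_mul]

lemma natDegree_divByMonic_X_pow_le {f : S[X]} {m d : ℕ} (hf : f.natDegree ≤ m + d) :
    (f /ₘ X ^ m).natDegree ≤ d :=
  natDegree_le_iff_coeff_eq_zero.2 fun n hn => by
    rw [coeff_divByMonic_X_pow]
    exact coeff_eq_zero_of_natDegree_lt (by omega)

lemma coeff_X_mul_derivative (f : S[X]) (n : ℕ) : (X * derivative f).coeff n = n * f.coeff n := by
  cases n with
  | zero => simp
  | succ n => rw [coeff_X_mul, coeff_derivative, mul_comm, Nat.cast_succ]

lemma natDegree_X_mul_derivative_le (f : S[X]) : (X * derivative f).natDegree ≤ f.natDegree :=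
  natDegree_le_iff_coeff_eq_zero.2 fun n hn => by
    rw [coeff_X_mul_derivative, coeff_eq_zero_of_natDegree_lt hn, mul_zero]

lemma coeff_mul_divByMonic_X_pow_sub (f g : S[X]) (m n : ℕ) :
    (g * (f /ₘ X ^ m) - f * (g /ₘ X ^ m)).coeff n =
      ∑ r ∈ Finset.range (n + 1),
        (f.coeff (m + n - r) * g.coeff r - f.coeff r * g.coeff (m + n - r)) := by
  simp only [coeff_sub, coeff_mul, coeff_divByMonic_X_pow,
    Finset.Nat.sum_antidiagonal_eq_sum_range_succ_mk, ← Finset.sum_sub_distrib]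
  refine Finset.sum_congr rfl fun r hr => ?_
  rw [Nat.add_sub_assoc (Finset.mem_range_succ_iff.1 hr)]
  ring

/-- In `g (f div X^m) - f (g div X^m)` the contributions of the quotients cancel, so only the
remainders, of degree less than `m`, matter. -/
lemma coeff_mul_divByMonic_X_pow_sub_of_natDegree_le {f g : S[X]} (m : ℕ) {n : ℕ}
    (hf : f.natDegree ≤ n + 1) (hg : g.natDegree ≤ n + 1) :
    (g * (f /ₘ X ^ (m + 1)) - f * (g /ₘ X ^ (m + 1))).coeff n =
      f.coeff (n + 1) * g.coeff m - g.coeff (n + 1) * f.coeff m := by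
  nontriviality S
  have hmod (p : S[X]) : (p %ₘ X ^ (m + 1)).natDegree ≤ m := by
    have h := natDegree_modByMonic_lt p (monic_X_pow (m + 1)) fun h => by
      simpa using congrArg natDegree h
    rw [natDegree_X_pow] at h
    omega
  have hcoeff (p : S[X]) : (p %ₘ X ^ (m + 1)).coeff m = p.coeff m := by
    conv_rhs => rw [← modByMonic_add_div p (X ^ (m + 1)), coeff_add, coeff_X_pow_mul',
      if_neg (by omega), add_zero]
  have hcancel : (g * (f /ₘ X ^ (m + 1)) - f * (g /ₘ X ^ (m + 1))) * X ^ (m + 1) =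
      f * (g %ₘ X ^ (m + 1)) - g * (f %ₘ X ^ (m + 1)) := by
    linear_combination g * modByMonic_add_div f (X ^ (m + 1)) -
      f * modByMonic_add_div g (X ^ (m + 1))
  rw [← coeff_mul_X_pow _ (m + 1), hcancel, show n + (m + 1) = n + 1 + m by ring, coeff_sub,
    coeff_mul_add_eq_of_natDegree_le hf (hmod g), coeff_mul_add_eq_of_natDegree_le hg (hmod f),
    hcoeff, hcoeff]

end ShiftedPolynomials

section ShiftedResidual

variable {S : Type*} [CommRing S]

/-- The common shape of the residual polynomials of `ξ^2_j` and `ξ^3_j`: the pair `(g, w)` is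
`(polyU, W₁)` for the second family and `(polyV, W₂)` for the third one, and `f` is `polyU` for the
first residual and `polyV` for the second one. Modulo `w = g` it is the product of `f'` and a
factor independent of `f`, namely the `y`-component of the lift. -/
def shiftedResidual (k : ℕ) (g : S[X]) (w l : S) (j : ℕ) (f : S[X]) : S[X] :=
  derivative f * (C (k : S) * X * (g /ₘ X ^ (k - j + 1)) + C l) +
    C (k : S) * (C w - g) * ((X * derivative f) /ₘ X ^ (k - j + 1))

lemma shiftedResidual_eq (k : ℕ) (g : S[X]) (w l : S) (j : ℕ) (f : S[X]) :
    shiftedResidual k g w l j f =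
      C (k * w) * ((X * derivative f) /ₘ X ^ (k - j + 1)) + C l * derivative f -
        C (k : S) * (g * ((X * derivative f) /ₘ X ^ (k - j + 1)) -
          X * derivative f * (g /ₘ X ^ (k - j + 1))) := by
  rw [shiftedResidual, C_mul]
  ring

lemma coeff_shiftedResidual {k j : ℕ} (hj : j ≤ k) {g : S[X]} (hg : g.coeff 0 = 0) (w l : S)
    (f : S[X]) (n : ℕ) : (shiftedResidual k g w l j f).coeff n =
      k * w * ((k + n - j + 1) * f.coeff (k + n - j + 1)) + l * ((n + 1) * f.coeff (n + 1)) -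
        k * ∑ r ∈ Finset.Icc 1 n,
          ((k + n - j - r + 1) * f.coeff (k + n - j - r + 1) * g.coeff r -
            r * f.coeff r * g.coeff (k + n - j - r + 1)) := by
  simp only [shiftedResidual_eq, coeff_sub (C _ * _ + _), coeff_add, coeff_C_mul,
    coeff_divByMonic_X_pow, coeff_X_mul_derivative, coeff_derivative,
    coeff_mul_divByMonic_X_pow_sub]
  rw [Finset.range_eq_Ico, Finset.sum_eq_sum_Ico_succ_bot n.succ_pos, hg, Nat.cast_zero, mul_zero,
    zero_mul, zero_mul, sub_zero, zero_add, Nat.succ_eq_add_one, zero_add,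
    Finset.Ico_add_one_right_eq_Icc]
  have hindex (r : ℕ) (hr : r ≤ n) : k - j + 1 + n - r = k + n - j - r + 1 := by omega
  have hcast (r : ℕ) (hr : r ≤ n) : ((k + n - j - r + 1 : ℕ) : S) = k + n - j - r + 1 := by
    rw [Nat.cast_succ, Nat.cast_sub (by omega), Nat.cast_sub (by omega), Nat.cast_add]
  have hindex₀ := hindex 0 n.zero_le
  have hcast₀ := hcast 0 n.zero_le
  simp only [Nat.sub_zero, Nat.cast_zero, sub_zero] at hindex₀ hcast₀
  rw [Finset.sum_congr rfl fun r hr => by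
    rw [hindex r (Finset.mem_Icc.1 hr).2, hcast r (Finset.mem_Icc.1 hr).2],
    hindex₀, hcast₀, mul_comm (f.coeff (n + 1))]

lemma coeff_shiftedResidual_of_natDegree_le {k j : ℕ} (hj : j < k) {g : S[X]} (w l : S)
    {f : S[X]} {n : ℕ} (hf : f.natDegree ≤ n + 1) (hg : g.natDegree ≤ n + 1) :
    (shiftedResidual k g w l j f).coeff n =
      (l - k * g.coeff (k - j)) * ((n + 1) * f.coeff (n + 1)) +
        k * g.coeff (n + 1) * ((k - j) * f.coeff (k - j)) := by
  rw [shiftedResidual_eq, coeff_sub, coeff_add, coeff_C_mul, coeff_C_mul, coeff_C_mul,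
    coeff_mul_divByMonic_X_pow_sub_of_natDegree_le (k - j)
      ((natDegree_X_mul_derivative_le f).trans hf) hg,
    coeff_divByMonic_X_pow, coeff_X_mul_derivative, coeff_X_mul_derivative,
    coeff_X_mul_derivative, coeff_derivative,
    coeff_eq_zero_of_natDegree_lt (n := k - j + 1 + n) (by omega), Nat.cast_sub hj.le]
  push_cast
  ring

end ShiftedResidual

section Residual

variable {S τ : Type*} [CommRing S] {N : ℕ}

/-- The polynomial `ξ_c - ∑ ξ_{a i} X^{i+1}` built from components of a vector field `ξ`. If the
coordinate labelled `c` is a function `∑ x_{a i} y^{i+1} + ⋯` of the coordinates labelled `a i`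
and of `y`, then it measures the change along `ξ` that has to be compensated by moving `y`. -/
def residual (c : τ) (a : Fin N → τ) : (τ → S) →ₗ[S] S[X] :=
  monomial 0 ∘ₗ LinearMap.proj c - ∑ i : Fin N, monomial ((i : ℕ) + 1) ∘ₗ LinearMap.proj (a i)

lemma residual_apply (c : τ) (a : Fin N → τ) (ξ : τ → S) :
    residual c a ξ = C (ξ c) - ∑ i, C (ξ (a i)) * X ^ ((i : ℕ) + 1) := by
  simp [residual, C_mul_X_pow_eq_monomial]

lemma coeff_residual_zero (c : τ) (a : Fin N → τ) (ξ : τ → S) :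
    (residual c a ξ).coeff 0 = ξ c := by
  simp [residual_apply, finsetSum_coeff]

lemma coeff_residual_succ (c : τ) (a : Fin N → τ) (ξ : τ → S) (i : Fin N) :
    (residual c a ξ).coeff (i + 1) = -ξ (a i) := by
  simp [residual_apply, finsetSum_coeff, coeff_C_succ, coeff_X_pow, Fin.val_inj]

lemma residual_mem_degreeLT (c : τ) (a : Fin N → τ) (ξ : τ → S) :
    residual c a ξ ∈ degreeLT S (N + 1) := by
  rw [residual_apply]
  refine sub_mem (mem_degreeLT.2 (degree_C_le.trans_lt (by exact_mod_cast N.succ_pos)))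
    (sum_mem fun i _ => mem_degreeLT.2 ((degree_C_mul_X_pow_le _ _).trans_lt ?_))
  exact_mod_cast Nat.succ_lt_succ i.isLt

lemma residual_eq {c : τ} {a : Fin N → τ} {ξ : τ → S} {f : S[X]} (hc : f.coeff 0 = ξ c)
    (ha : ∀ i : Fin N, f.coeff (i + 1) = -ξ (a i)) (hf : ∀ n, N < n → f.coeff n = 0) :
    residual c a ξ = f := by
  ext n
  obtain hn | hn := lt_or_ge N n
  · rw [hf n hn, coeff_eq_zero_of_degree_lt]
    exact (mem_degreeLT.1 (residual_mem_degreeLT c a ξ)).trans_le (by exact_mod_cast hn)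
  · cases n with
    | zero => rw [coeff_residual_zero, hc]
    | succ n => rw [coeff_residual_succ c a ξ ⟨n, hn⟩, ha ⟨n, hn⟩]

end Residual

section Generators

variable (k : ℕ) (𝕜 : Type*) [RCLike 𝕜]

/-- The first nontrivial component `y^k + ∑ u_i y^i` of the cross cap mapping, as a polynomial in
`y = X`. It is a polynomial over the ring of the target because `u_i` and `U_i` correspond. -/
def polyU : (Poly k 𝕜)[X] :=
  X ^ k + ∑ i : Fin (k - 2), C (MvPolynomial.X (.inl i)) * X ^ ((i : ℕ) + 1)

/-- The second nontrivial component `∑ v_i y^i` of the cross cap mapping, as a polynomial in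
`y = X`. -/
def polyV : (Poly k 𝕜)[X] :=
  ∑ i : Fin (k - 1), C (MvPolynomial.X (.inr (.inl i))) * X ^ ((i : ℕ) + 1)

/-- The polynomial `C₁ - ∑ A_i y^i` of a vector field. -/
abbrev residual₁ : PolyField k 𝕜 →ₗ[Poly k 𝕜] (Poly k 𝕜)[X] :=
  residual (.inr (.inr 0)) fun i : Fin (k - 2) => .inl i

/-- The polynomial `C₂ - ∑ B_i y^i` of a vector field. -/
abbrev residual₂ : PolyField k 𝕜 →ₗ[Poly k 𝕜] (Poly k 𝕜)[X] :=
  residual (.inr (.inr 1)) fun i : Fin (k - 1) => .inr (.inl i)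

variable {k 𝕜}

lemma coeff_sum_C_mul_X_pow_succ {S : Type*} [Semiring S] {N : ℕ} (a : Fin N → S) (n : ℕ) :
    (∑ i, C (a i) * X ^ ((i : ℕ) + 1)).coeff n =
      if h : 1 ≤ n ∧ n ≤ N then a ⟨n - 1, by omega⟩ else 0 := by
  simp only [finsetSum_coeff, coeff_C_mul, coeff_X_pow, mul_ite, mul_one, mul_zero]
  split_ifs with h
  · rw [Finset.sum_eq_single_of_mem (⟨n - 1, by omega⟩ : Fin N) (Finset.mem_univ _)]
    · exact if_pos (by simp only; omega)
    · exact fun i _ hi => if_neg fun hn => hi (Fin.ext (by simp only; omega))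
  · exact Finset.sum_eq_zero fun i _ => if_neg (by omega)

@[simp] lemma coeff_polyU (n : ℕ) : (polyU k 𝕜).coeff n = U k 𝕜 n := by
  rw [polyU, coeff_add, coeff_sum_C_mul_X_pow_succ, coeff_X_pow, U]
  split_ifs
  · omega
  all_goals simp

@[simp] lemma coeff_polyV (n : ℕ) : (polyV k 𝕜).coeff n = V k 𝕜 n :=
  coeff_sum_C_mul_X_pow_succ _ n

lemma U_zero (hk : 2 ≤ k) : U k 𝕜 0 = 0 := by
  rw [U, dif_neg (by omega), if_neg (by omega)]

lemma U_pred (hk : 2 ≤ k) : U k 𝕜 (k - 1) = 0 := by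
  rw [U, dif_neg (by omega), if_neg (by omega)]

lemma U_self : U k 𝕜 k = 1 := by
  rw [U, dif_neg (by omega), if_pos rfl]

lemma U_of_lt {r : ℕ} (h : k < r) : U k 𝕜 r = 0 := by
  rw [U, dif_neg (by omega), if_neg (by omega)]

lemma V_zero : V k 𝕜 0 = 0 := by
  rw [V, dif_neg (by omega)]

lemma V_of_lt {r : ℕ} (h : k - 1 < r) : V k 𝕜 r = 0 := by
  rw [V, dif_neg (by omega)]

lemma natDegree_polyU : (polyU k 𝕜).natDegree = k := by
  refine natDegree_eq_of_le_of_coeff_ne_zero (natDegree_le_iff_coeff_eq_zero.2 fun n hn => ?_) ?_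
  · rw [coeff_polyU, U_of_lt hn]
  · rw [coeff_polyU, U_self]
    exact one_ne_zero

lemma natDegree_polyV_le : (polyV k 𝕜).natDegree ≤ k - 1 :=
  natDegree_le_iff_coeff_eq_zero.2 fun n hn => by rw [coeff_polyV, V_of_lt hn]

lemma residual₁_mkField {A B : ℕ → Poly k 𝕜} {C₁ C₂ : Poly k 𝕜} {f : (Poly k 𝕜)[X]}
    (h0 : f.coeff 0 = C₁) (hA : ∀ n, 1 ≤ n → n < k - 1 → f.coeff n = -A n)
    (hf : ∀ n, k - 1 ≤ n → f.coeff n = 0) : residual₁ k 𝕜 (mkField A B C₁ C₂) = f :=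
  residual_eq h0 (fun i => hA _ (by omega) (by omega)) fun n hn => hf n (by omega)

lemma residual₂_mkField {A B : ℕ → Poly k 𝕜} {C₁ C₂ : Poly k 𝕜} {f : (Poly k 𝕜)[X]}
    (h0 : f.coeff 0 = C₂) (hB : ∀ n, 1 ≤ n → n < k → f.coeff n = -B n)
    (hf : ∀ n, k ≤ n → f.coeff n = 0) : residual₂ k 𝕜 (mkField A B C₁ C₂) = f :=
  residual_eq h0 (fun i => hB _ (by omega) (by omega)) fun n hn => hf n (by omega)

lemma residual₁_eulerField (hk : 2 ≤ k) : residual₁ k 𝕜 (eulerField k 𝕜) =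
    X * derivative (polyU k 𝕜) + C (k : Poly k 𝕜) * (C (W₁ k 𝕜) - polyU k 𝕜) := by
  refine residual₁_mkField ?_ (fun n hn _ => ?_) fun n hn => ?_ <;>
    rw [coeff_add, coeff_X_mul_derivative, coeff_C_mul, coeff_sub, coeff_C, coeff_polyU]
  · simp [U_zero hk]
  · rw [if_neg (by omega)]
    ring
  · rw [if_neg (by omega)]
    obtain rfl | rfl | hn : n = k - 1 ∨ n = k ∨ k < n := by omega
    · rw [U_pred hk]
      ring
    · ring
    · rw [U_of_lt hn]
      ring

lemma residual₂_eulerField (hk : 2 ≤ k) : residual₂ k 𝕜 (eulerField k 𝕜) =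
    X * derivative (polyV k 𝕜) + C (k : Poly k 𝕜) * (C (W₂ k 𝕜) - polyV k 𝕜) := by
  refine residual₂_mkField ?_ (fun n hn _ => ?_) fun n hn => ?_ <;>
    rw [coeff_add, coeff_X_mul_derivative, coeff_C_mul, coeff_sub, coeff_C, coeff_polyV]
  · simp [V_zero]
  · rw [if_neg (by omega)]
    ring
  · rw [if_neg (by omega), V_of_lt (by omega)]
    ring

/-- The value of `l` is the one for which the coefficient of `X^(k-1)` vanishes. -/
lemma coeff_shiftedResidual_polyU_eq_zero {g : (Poly k 𝕜)[X]} (hg : g.natDegree ≤ k)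
    (w : Poly k 𝕜) {l : Poly k 𝕜} {j : ℕ} (hj : j < k)
    (hl : l = k * g.coeff (k - j) - (k - j) * U k 𝕜 (k - j) * g.coeff k) {n : ℕ}
    (hn : k - 1 ≤ n) : (shiftedResidual k g w l j (polyU k 𝕜)).coeff n = 0 := by
  rw [coeff_shiftedResidual_of_natDegree_le hj _ _ (by rw [natDegree_polyU]; omega) (by omega)]
  simp only [coeff_polyU]
  obtain hn | rfl : k < n + 1 ∨ k = n + 1 := by omega
  · rw [U_of_lt hn, coeff_eq_zero_of_natDegree_lt (hg.trans_lt hn)]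
    ring
  · rw [U_self, hl]
    push_cast
    ring

lemma coeff_shiftedResidual_polyV_eq_zero {g : (Poly k 𝕜)[X]} (hg : g.natDegree ≤ k)
    (w l : Poly k 𝕜) {j : ℕ} (hj : j < k) {n : ℕ} (hn : k ≤ n) :
    (shiftedResidual k g w l j (polyV k 𝕜)).coeff n = 0 := by
  rw [coeff_shiftedResidual_of_natDegree_le hj _ _
    (natDegree_polyV_le.trans (by omega)) (by omega), coeff_polyV (n + 1), V_of_lt (by omega),
    coeff_eq_zero_of_natDegree_lt (n := n + 1) (by omega)]
  ring

lemma residual₁_field₂ (hk : 2 ≤ k) {j : ℕ} (hj : j < k) : residual₁ k 𝕜 (field₂ k 𝕜 j) =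
    shiftedResidual k (polyU k 𝕜) (W₁ k 𝕜) (j * U k 𝕜 (k - j)) j (polyU k 𝕜) := by
  have hcoeff := coeff_shiftedResidual (S := Poly k 𝕜) (g := polyU k 𝕜) hj.le
    ((coeff_polyU 0).trans (U_zero hk)) (W₁ k 𝕜) (j * U k 𝕜 (k - j)) (polyU k 𝕜)
  simp only [coeff_polyU] at hcoeff
  refine residual₁_mkField ?_ (fun n _ _ => ?_) fun n hn =>
    coeff_shiftedResidual_polyU_eq_zero natDegree_polyU.le _ hj ?_ hn
  · rw [hcoeff, Finset.Icc_eq_empty (by omega)]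
    simp only [Finset.sum_empty, Nat.cast_zero, add_zero, zero_add, sub_zero, mul_zero]
    ring
  · rw [hcoeff, Finset.sum_congr (g := fun r : ℕ => ((k : Poly k 𝕜) + n - j - 2 * r + 1) *
      U k 𝕜 r * U k 𝕜 (k + n - j - r + 1)) rfl fun r _ => by ring]
    ring
  · rw [coeff_polyU, coeff_polyU, U_self]
    ring

lemma residual₂_field₂ (hk : 2 ≤ k) {j : ℕ} (hj : j < k) : residual₂ k 𝕜 (field₂ k 𝕜 j) =
    shiftedResidual k (polyU k 𝕜) (W₁ k 𝕜) (j * U k 𝕜 (k - j)) j (polyV k 𝕜) := by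
  have hcoeff := coeff_shiftedResidual (S := Poly k 𝕜) (g := polyU k 𝕜) hj.le
    ((coeff_polyU 0).trans (U_zero hk)) (W₁ k 𝕜) (j * U k 𝕜 (k - j)) (polyV k 𝕜)
  simp only [coeff_polyU, coeff_polyV, Finset.sum_sub_distrib] at hcoeff
  refine residual₂_mkField ?_ (fun n _ _ => ?_) fun n hn =>
    coeff_shiftedResidual_polyV_eq_zero natDegree_polyU.le _ _ hj hn
  · rw [hcoeff, Finset.Icc_eq_empty (by omega)]
    simp only [Finset.sum_empty, Nat.cast_zero, add_zero, zero_add, sub_zero, mul_zero]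
    ring
  · simp only [hcoeff, mul_right_comm _ (V k 𝕜 _) (U k 𝕜 _)]
    ring

lemma residual₁_field₃ {j : ℕ} (hj : j < k) : residual₁ k 𝕜 (field₃ k 𝕜 j) =
    shiftedResidual k (polyV k 𝕜) (W₂ k 𝕜) (k * V k 𝕜 (k - j)) j (polyU k 𝕜) := by
  have hcoeff := coeff_shiftedResidual (S := Poly k 𝕜) (g := polyV k 𝕜) hj.le
    ((coeff_polyV 0).trans V_zero) (W₂ k 𝕜) (k * V k 𝕜 (k - j)) (polyU k 𝕜)
  simp only [coeff_polyU, coeff_polyV, Finset.sum_sub_distrib] at hcoeff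
  refine residual₁_mkField ?_ (fun n _ _ => ?_) fun n hn =>
    coeff_shiftedResidual_polyU_eq_zero (natDegree_polyV_le.trans (k.sub_le 1)) _ hj ?_ hn
  · rw [hcoeff, Finset.Icc_eq_empty (by omega)]
    simp only [Finset.sum_empty, Nat.cast_zero, add_zero, zero_add, sub_zero, mul_zero]
    ring
  · rw [hcoeff]
    ring
  · rw [coeff_polyV, coeff_polyV, V_of_lt (r := k) (by omega)]
    ring

lemma residual₂_field₃ {j : ℕ} (hj : j < k) : residual₂ k 𝕜 (field₃ k 𝕜 j) =
    shiftedResidual k (polyV k 𝕜) (W₂ k 𝕜) (k * V k 𝕜 (k - j)) j (polyV k 𝕜) := by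
  have hcoeff := coeff_shiftedResidual (S := Poly k 𝕜) (g := polyV k 𝕜) hj.le
    ((coeff_polyV 0).trans V_zero) (W₂ k 𝕜) (k * V k 𝕜 (k - j)) (polyV k 𝕜)
  simp only [coeff_polyV] at hcoeff
  refine residual₂_mkField ?_ (fun n _ _ => ?_) fun n hn =>
    coeff_shiftedResidual_polyV_eq_zero (natDegree_polyV_le.trans (k.sub_le 1)) _ _ hj hn
  · rw [hcoeff, Finset.Icc_eq_empty (by omega)]
    simp only [Finset.sum_empty, Nat.cast_zero, add_zero, zero_add, sub_zero, mul_zero]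
    ring
  · rw [hcoeff, Finset.sum_congr (g := fun r : ℕ => ((k : Poly k 𝕜) + n - j - 2 * r + 1) *
      V k 𝕜 r * V k 𝕜 (k + n - j - r + 1)) rfl fun r _ => by ring]
    ring

lemma residual₁_field₁ (j : ℕ) : residual₁ k 𝕜 (field₁ k 𝕜 j) =
    ((k - j) * U k 𝕜 j) • residual₁ k 𝕜 (eulerField k 𝕜) := by
  rw [← map_smul]
  simp only [residual_apply, field₁, eulerField, mkField, Pi.smul_apply, smul_eq_mul]
  exact congrArg₂ _ (congrArg C (by ring)) (Finset.sum_congr rfl fun i _ => by congr 2; ring)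

lemma coeff_mul_derivative_add_sub {S : Type*} [CommRing S] (f g : S[X]) (c s t w₁ w₂ : S)
    (j n : ℕ) : (C s * (X * derivative f) + (C w₂ - f) * (C c * (g /ₘ X ^ j) - C t) -
        C c * (C w₁ - g) * (f /ₘ X ^ j)).coeff n =
      (s * n + t) * f.coeff n + c * w₂ * g.coeff (j + n) - c * w₁ * f.coeff (j + n) -
        (if n = 0 then w₂ * t else 0) + c * (g * (f /ₘ X ^ j) - f * (g /ₘ X ^ j)).coeff n := by
  have hexpand : C s * (X * derivative f) + (C w₂ - f) * (C c * (g /ₘ X ^ j) - C t) -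
        C c * (C w₁ - g) * (f /ₘ X ^ j) =
      C s * (X * derivative f) + C t * f + C (c * w₂) * (g /ₘ X ^ j) -
        C (c * w₁) * (f /ₘ X ^ j) - C (w₂ * t) +
        C c * (g * (f /ₘ X ^ j) - f * (g /ₘ X ^ j)) := by
    simp only [C_mul]
    ring
  rw [hexpand, coeff_add, coeff_sub, coeff_sub, coeff_add, coeff_add, coeff_C]
  simp only [coeff_C_mul, coeff_X_mul_derivative, coeff_divByMonic_X_pow]
  ring

lemma residual₂_field₁ (hk : 2 ≤ k) {j : ℕ} (hj : 1 ≤ j) : residual₂ k 𝕜 (field₁ k 𝕜 j) =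
    C ((k - j) * U k 𝕜 j) * (X * derivative (polyV k 𝕜)) +
      (C (W₂ k 𝕜) - polyV k 𝕜) * (C (k : Poly k 𝕜) * (polyU k 𝕜 /ₘ X ^ j) - C (j * U k 𝕜 j)) -
      C (k : Poly k 𝕜) * (C (W₁ k 𝕜) - polyU k 𝕜) * (polyV k 𝕜 /ₘ X ^ j) := by
  refine residual₂_mkField ?_ (fun n hn _ => ?_) fun n hn => ?_ <;>
    rw [coeff_mul_derivative_add_sub]
  · rw [coeff_mul_divByMonic_X_pow_sub]
    simp only [coeff_polyU, coeff_polyV, U_zero hk, V_zero, zero_add, Finset.sum_range_one,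
      add_zero, if_true]
    ring
  · obtain ⟨m, rfl⟩ := Nat.exists_eq_add_of_le' hn
    rw [coeff_mul_divByMonic_X_pow_sub, Finset.range_eq_Ico,
      Finset.sum_eq_sum_Ico_succ_bot (Nat.succ_pos _), zero_add, Nat.succ_eq_add_one,
      Finset.Ico_add_one_right_eq_Icc, Finset.sum_sub_distrib]
    simp only [coeff_polyU, coeff_polyV, U_zero hk, V_zero, if_neg m.succ_ne_zero,
      Nat.add_sub_cancel, add_comm j]
    rw [Finset.sum_Icc_succ_top (b := m) (by omega) fun r => V k 𝕜 r * U k 𝕜 (m + 1 + j - r),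
      Nat.add_sub_cancel_left]
    simp only [mul_comm (V k 𝕜 _) (U k 𝕜 _)]
    push_cast
    ring
  · obtain ⟨m, rfl⟩ := Nat.exists_eq_add_of_le' hj
    rw [coeff_mul_divByMonic_X_pow_sub_of_natDegree_le m (natDegree_polyV_le.trans (by omega))
      (by rw [natDegree_polyU]; omega)]
    simp only [coeff_polyU, coeff_polyV]
    rw [if_neg (by omega), V_of_lt (r := n) (by omega), V_of_lt (r := m + 1 + n) (by omega),
      V_of_lt (r := n + 1) (by omega), U_of_lt (r := m + 1 + n) (by omega),
      U_of_lt (r := n + 1) (by omega)]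
    ring

end Generators

section CoefficientReduction

variable {F S : Type*} [CommRing F] [CommRing S] [Algebra F S]

/-- The polynomials over `S` all of whose coefficients lie in the subalgebra `T`. -/
def coeffsIn (T : Subalgebra F S) : Subalgebra F S[X] := (mapAlgHom T.val).range

variable {T : Subalgebra F S} {f : S[X]}

lemma mem_coeffsIn : f ∈ coeffsIn T ↔ ∀ n, f.coeff n ∈ T := by
  refine (mem_map_range (T.val : T →+* S)).trans (forall_congr' fun n => ?_)
  simp

lemma coeffsIn_mono {T' : Subalgebra F S} (h : T ≤ T') : coeffsIn T ≤ coeffsIn T' :=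
  fun _ hf => mem_coeffsIn.2 fun n => h (mem_coeffsIn.1 hf n)

lemma C_mem_coeffsIn {s : S} (hs : s ∈ T) : C s ∈ coeffsIn T :=
  ⟨C ⟨s, hs⟩, map_C _⟩

lemma X_mem_coeffsIn : X ∈ coeffsIn T :=
  ⟨X, map_X _⟩

lemma derivative_mem_coeffsIn (hf : f ∈ coeffsIn T) : derivative f ∈ coeffsIn T := by
  obtain ⟨g, rfl⟩ := hf
  exact ⟨derivative g, (derivative_map g (T.val : T →+* S)).symm⟩

lemma divByMonic_X_pow_mem_coeffsIn (hf : f ∈ coeffsIn T) (m : ℕ) :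
    f /ₘ X ^ m ∈ coeffsIn T :=
  mem_coeffsIn.2 fun n => by
    rw [coeff_divByMonic_X_pow]
    exact mem_coeffsIn.1 hf _

lemma smul_mem_coeffsIn {t : S} (ht : t ∈ T) (hf : f ∈ coeffsIn T) : t • f ∈ coeffsIn T := by
  rw [smul_eq_C_mul]
  exact mul_mem (C_mem_coeffsIn ht) hf

lemma smul_mem_of_forall_generator {A : Type*} [AddCommGroup A] [Module F A] [Module S A]
    [IsScalarTower F S A] {G : Set S} (hG : Algebra.adjoin F G = ⊤) {K : Submodule F A}
    (hK : ∀ s ∈ G, ∀ a ∈ K, s • a ∈ K) (s : S) {a : A} (ha : a ∈ K) : s • a ∈ K := by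
  have hs : s ∈ Algebra.adjoin F G := hG ▸ Algebra.mem_top
  induction hs using Algebra.adjoin_induction generalizing a with
  | mem s hs => exact hK s hs a ha
  | algebraMap r =>
    rw [algebraMap_smul]
    exact K.smul_mem r ha
  | add s t _ _ hs ht =>
    rw [add_smul]
    exact add_mem (hs ha) (ht ha)
  | mul s t _ _ hs ht =>
    rw [mul_smul]
    exact hs (ht ha)

variable {n : ℕ} {M : Submodule S S[X]} {W : Set S}

lemma degree_sub_smul_lt {d : ℕ} {H : S[X]} {c : Fˣ} (hf : f.degree < (d + 1 : ℕ))
    (hH : H.natDegree ≤ d) (hc : H.coeff d = algebraMap F S c) :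
    (f - (algebraMap F S ↑c⁻¹ * f.coeff d) • H).degree < d := by
  rw [degree_lt_iff_coeff_zero] at hf ⊢
  intro m hm
  obtain rfl | hm := hm.eq_or_lt
  · rw [coeff_sub, coeff_smul, hc, smul_eq_mul, mul_right_comm, ← map_mul, Units.inv_mul, map_one,
      one_mul, sub_self]
  · rw [coeff_sub, coeff_smul, hf m hm, coeff_eq_zero_of_natDegree_lt (hH.trans_lt hm), smul_zero,
      sub_zero]

/-- A polynomial over `T` of degree `d` is a `T`-multiple of `H` up to smaller degree. -/
lemma smul_mem_of_forall_degree_lt {K : Submodule F S[X]} (hT : ∀ t ∈ T, ∀ p ∈ K, t • p ∈ K)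
    {w : S} (hw : ∀ d < n, ∃ H ∈ coeffsIn T, H.natDegree ≤ d ∧
      (∃ c : Fˣ, H.coeff d = algebraMap F S c) ∧ w • H ∈ K)
    (hf : f ∈ coeffsIn T) (hfn : f.degree < n) : w • f ∈ K := by
  induction n generalizing f with
  | zero =>
    rw [degree_lt_iff_coeff_zero] at hfn
    rw [show f = 0 from ext fun m => hfn m m.zero_le, smul_zero]
    exact zero_mem K
  | succ d ih =>
    obtain ⟨H, hH, hHd, ⟨c, hc⟩, hwH⟩ := hw d d.lt_succ_self
    have ht : algebraMap F S ↑c⁻¹ * f.coeff d ∈ T :=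
      mul_mem (T.algebraMap_mem _) (mem_coeffsIn.1 hf d)
    rw [← sub_add_cancel f ((algebraMap F S ↑c⁻¹ * f.coeff d) • H), smul_add, smul_comm w _ H]
    exact add_mem (ih (fun e he => hw e (by omega)) (sub_mem hf (smul_mem_coeffsIn ht hH))
      (degree_sub_smul_lt hfn hHd hc)) (hT _ ht _ hwH)

/-- The sum of `M` and the polynomials over `T` of degree less than `n` is stable under `T` and
`W`, hence under the whole ring `S`. -/
theorem exists_sub_mem_coeffsIn (hT : Algebra.adjoin F (T ∪ W) = ⊤) (hM : M ≤ degreeLT S n)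
    (hW : ∀ w ∈ W, ∀ d < n, ∃ H ∈ coeffsIn T, H.natDegree ≤ d ∧
      (∃ c : Fˣ, H.coeff d = algebraMap F S c) ∧ ∃ m ∈ M, w • H - m ∈ coeffsIn T)
    (hf : f ∈ degreeLT S n) : ∃ m ∈ M, f - m ∈ coeffsIn T := by
  let K : Submodule F S[X] := M.restrictScalars F ⊔
    Subalgebra.toSubmodule (coeffsIn T) ⊓ (degreeLT S n).restrictScalars F
  have hMK : ∀ m ∈ M, m ∈ K := fun m hm => Submodule.mem_sup_left hm
  have hTK : ∀ p ∈ coeffsIn T, p ∈ degreeLT S n → p ∈ K := fun p hp hpn =>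
    Submodule.mem_sup_right ⟨hp, hpn⟩
  have hsmul : ∀ s : S, (∀ p ∈ coeffsIn T, p ∈ degreeLT S n → s • p ∈ K) → ∀ p ∈ K, s • p ∈ K :=
    fun s hs p hp => by
      obtain ⟨m, hm, q, hq, rfl⟩ := Submodule.mem_sup.1 hp
      rw [smul_add]
      exact add_mem (hMK _ (M.smul_mem s hm)) (hs q hq.1 hq.2)
  have hT_smul : ∀ t ∈ T, ∀ p ∈ K, t • p ∈ K := fun t ht => hsmul t fun p hp hpn =>
    hTK _ (smul_mem_coeffsIn ht hp) ((degreeLT S n).smul_mem t hpn)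
  have hW_smul : ∀ w ∈ W, ∀ p ∈ K, w • p ∈ K := fun w hw => hsmul w fun p hp hpn => by
    refine smul_mem_of_forall_degree_lt hT_smul (fun d hd => ?_) hp (mem_degreeLT.1 hpn)
    obtain ⟨H, hH, hHd, hc, m, hm, hHm⟩ := hW w hw d hd
    refine ⟨H, hH, hHd, hc, ?_⟩
    rw [← add_sub_cancel m (w • H)]
    refine add_mem (hMK m hm) (hTK _ hHm (sub_mem ((degreeLT S n).smul_mem w ?_) (hM hm)))
    exact mem_degreeLT.2 (degree_le_natDegree.trans_lt (by exact_mod_cast hHd.trans_lt hd))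
  suffices hfK : f ∈ K by
    obtain ⟨m, hm, p, hp, rfl⟩ := Submodule.mem_sup.1 hfK
    exact ⟨m, hm, by simpa using hp.1⟩
  classical
  rw [degreeLT_eq_span_X_pow] at hf
  induction hf using Submodule.span_induction with
  | mem x hx =>
    obtain ⟨i, hi, rfl⟩ := Finset.mem_image.1 (Finset.mem_coe.1 hx)
    refine hTK _ (pow_mem X_mem_coeffsIn i) (mem_degreeLT.2 ((degree_X_pow_le i).trans_lt ?_))
    exact_mod_cast Finset.mem_range.1 hi
  | zero => exact zero_mem K
  | add x y _ _ hx hy => exact add_mem hx hy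
  | smul s x _ hx =>
    exact smul_mem_of_forall_generator hT (fun s hs => hs.elim (hT_smul s) (hW_smul s)) s hx

end CoefficientReduction

section Pullback

variable (k : ℕ) (𝕜 : Type*) [RCLike 𝕜]

/-- The components of the cross cap mapping as polynomials in `y = X`; the coordinates `u_i` and
`v_i` of the source are written `U_i` and `V_i`. -/
def crossCapPoly : Tgt k → (Poly k 𝕜)[X]
  | .inl i => C (MvPolynomial.X (.inl i))
  | .inr (.inl i) => C (MvPolynomial.X (.inr (.inl i)))
  | .inr (.inr 0) => polyU k 𝕜
  | .inr (.inr 1) => polyV k 𝕜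

/-- Restriction to the graph of the cross cap mapping: the coordinates of the target are replaced
by the components of the mapping, and the variable `X = y` is kept. -/
def pullback : (Poly k 𝕜)[X] →+* (Poly k 𝕜)[X] :=
  eval₂RingHom (MvPolynomial.aeval (crossCapPoly k 𝕜)).toRingHom X

/-- The polynomials in the coordinates `U_i` and `V_i`. -/
def algUV : Subalgebra 𝕜 (Poly k 𝕜) :=
  MvPolynomial.supported 𝕜 (Set.range fun i : Fin 2 => (.inr (.inr i) : Tgt k))ᶜ

variable {k 𝕜}

lemma pullback_C (s : Poly k 𝕜) :
    pullback k 𝕜 (C s) = MvPolynomial.aeval (crossCapPoly k 𝕜) s :=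
  eval₂_C _ _

lemma pullback_X : pullback k 𝕜 X = X :=
  eval₂_X _ _

lemma pullback_C_W₁ : pullback k 𝕜 (C (W₁ k 𝕜)) = polyU k 𝕜 := by
  rw [pullback_C, W₁, MvPolynomial.aeval_X]
  rfl

lemma pullback_C_W₂ : pullback k 𝕜 (C (W₂ k 𝕜)) = polyV k 𝕜 := by
  rw [pullback_C, W₂, MvPolynomial.aeval_X]
  rfl

lemma pullback_smul (s : Poly k 𝕜) (f : (Poly k 𝕜)[X]) :
    pullback k 𝕜 (s • f) = pullback k 𝕜 (C s) * pullback k 𝕜 f := by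
  rw [smul_eq_C_mul, map_mul]

lemma pullback_C_of_mem {s : Poly k 𝕜} (hs : s ∈ algUV k 𝕜) : pullback k 𝕜 (C s) = C s := by
  rw [pullback_C]
  refine AlgHom.adjoin_le_equalizer (MvPolynomial.aeval (crossCapPoly k 𝕜)) CAlgHom ?_ hs
  rintro _ ⟨i | i | i, ht, rfl⟩
  · exact MvPolynomial.aeval_X _ _
  · exact MvPolynomial.aeval_X _ _
  · exact absurd ⟨i, rfl⟩ ht

lemma pullback_eq_self {f : (Poly k 𝕜)[X]} (hf : f ∈ coeffsIn (algUV k 𝕜)) :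
    pullback k 𝕜 f = f := by
  rw [mem_coeffsIn] at hf
  conv_lhs => rw [as_sum_range_C_mul_X_pow f]
  conv_rhs => rw [as_sum_range_C_mul_X_pow f]
  simp only [map_sum, map_mul, map_pow, pullback_X, pullback_C_of_mem (hf _)]

lemma U_mem_algUV (r : ℕ) : U k 𝕜 r ∈ algUV k 𝕜 := by
  rw [U]
  split_ifs
  · exact MvPolynomial.X_mem_supported.2 (by simp)
  · exact one_mem _
  · exact zero_mem _

lemma V_mem_algUV (r : ℕ) : V k 𝕜 r ∈ algUV k 𝕜 := by
  rw [V]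
  split_ifs
  · exact MvPolynomial.X_mem_supported.2 (by simp)
  · exact zero_mem _

lemma polyU_mem_coeffsIn : polyU k 𝕜 ∈ coeffsIn (algUV k 𝕜) :=
  mem_coeffsIn.2 fun n => coeff_polyU (k := k) (𝕜 := 𝕜) n ▸ U_mem_algUV n

lemma polyV_mem_coeffsIn : polyV k 𝕜 ∈ coeffsIn (algUV k 𝕜) :=
  mem_coeffsIn.2 fun n => coeff_polyV (k := k) (𝕜 := 𝕜) n ▸ V_mem_algUV n

lemma pullback_C_W₁_sub : pullback k 𝕜 (C (W₁ k 𝕜) - polyU k 𝕜) = 0 := by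
  rw [map_sub, pullback_C_W₁, pullback_eq_self polyU_mem_coeffsIn, sub_self]

lemma pullback_C_W₂_sub : pullback k 𝕜 (C (W₂ k 𝕜) - polyV k 𝕜) = 0 := by
  rw [map_sub, pullback_C_W₂, pullback_eq_self polyV_mem_coeffsIn, sub_self]

lemma pullback_shiftedResidual {f g : (Poly k 𝕜)[X]} {w l : Poly k 𝕜}
    (hf : f ∈ coeffsIn (algUV k 𝕜)) (hg : g ∈ coeffsIn (algUV k 𝕜)) (hl : l ∈ algUV k 𝕜)
    (hw : pullback k 𝕜 (C w) = g) (j : ℕ) :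
    pullback k 𝕜 (shiftedResidual k g w l j f) =
      derivative f * (C (k : Poly k 𝕜) * X * (g /ₘ X ^ (k - j + 1)) + C l) := by
  rw [shiftedResidual]
  simp only [map_add, map_mul, map_sub, map_natCast, pullback_X, hw, pullback_eq_self hg,
    pullback_C_of_mem hl, pullback_eq_self (derivative_mem_coeffsIn hf),
    pullback_eq_self (divByMonic_X_pow_mem_coeffsIn hg _), sub_self, mul_zero, zero_mul, add_zero]

end Pullback

section AlgebraicallyLiftable

variable (k : ℕ) (𝕜 : Type*) [RCLike 𝕜]

/-- The vector fields with a polynomial lift. The `u`- and `v`-components of a lift are forced;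
`h` is its `y`-component. -/
def algLiftable : Submodule (Poly k 𝕜) (PolyField k 𝕜) where
  carrier := {ξ | ∃ h, pullback k 𝕜 (residual₁ k 𝕜 ξ) = derivative (polyU k 𝕜) * h ∧
    pullback k 𝕜 (residual₂ k 𝕜 ξ) = derivative (polyV k 𝕜) * h}
  add_mem' := by
    rintro ξ ζ ⟨h, h₁, h₂⟩ ⟨h', h₁', h₂'⟩
    refine ⟨h + h', ?_, ?_⟩ <;> rw [map_add, map_add, mul_add]
    · rw [h₁, h₁']
    · rw [h₂, h₂']
  zero_mem' := ⟨0, by simp, by simp⟩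
  smul_mem' := by
    rintro s ξ ⟨h, h₁, h₂⟩
    refine ⟨pullback k 𝕜 (C s) * h, ?_, ?_⟩ <;> rw [map_smul, pullback_smul, mul_left_comm]
    · rw [h₁]
    · rw [h₂]

/-- The module generated by the Euler field and the three families. -/
def genSpan : Submodule (Poly k 𝕜) (PolyField k 𝕜) :=
  Submodule.span _ (insert (eulerField k 𝕜)
    ((fun p : Fin 3 × ℕ => family k 𝕜 p.1 p.2) ''
      (Finset.univ ×ˢ Finset.Icc 1 (k - 1) : Finset (Fin 3 × ℕ))))

variable {k 𝕜}

lemma eulerField_mem_algLiftable (hk : 2 ≤ k) : eulerField k 𝕜 ∈ algLiftable k 𝕜 := by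
  refine ⟨X, ?_, ?_⟩
  · rw [residual₁_eulerField hk, map_add, map_mul, map_mul, pullback_C_W₁_sub, pullback_X,
      pullback_eq_self (derivative_mem_coeffsIn polyU_mem_coeffsIn)]
    ring
  · rw [residual₂_eulerField hk, map_add, map_mul, map_mul, pullback_C_W₂_sub, pullback_X,
      pullback_eq_self (derivative_mem_coeffsIn polyV_mem_coeffsIn)]
    ring

lemma field₁_mem_algLiftable (hk : 2 ≤ k) {j : ℕ} (hj : 1 ≤ j) :
    field₁ k 𝕜 j ∈ algLiftable k 𝕜 := by
  have hs : ((k : Poly k 𝕜) - j) * U k 𝕜 j ∈ algUV k 𝕜 :=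
    mul_mem (sub_mem (natCast_mem _ _) (natCast_mem _ _)) (U_mem_algUV j)
  refine ⟨C ((k - j) * U k 𝕜 j) * X, ?_, ?_⟩
  · rw [residual₁_field₁, pullback_smul, pullback_C_of_mem hs, residual₁_eulerField hk]
    simp only [map_add (pullback k 𝕜), map_mul (pullback k 𝕜), pullback_C_W₁_sub, pullback_X,
      pullback_eq_self (derivative_mem_coeffsIn polyU_mem_coeffsIn)]
    ring
  · rw [residual₂_field₁ hk hj, map_sub, map_add]
    simp only [map_mul (pullback k 𝕜), pullback_C_W₁_sub, pullback_C_W₂_sub, pullback_X,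
      pullback_C_of_mem hs, pullback_eq_self (derivative_mem_coeffsIn polyV_mem_coeffsIn)]
    ring

lemma field₂_mem_algLiftable (hk : 2 ≤ k) {j : ℕ} (hj : j < k) :
    field₂ k 𝕜 j ∈ algLiftable k 𝕜 := by
  have hl : (j : Poly k 𝕜) * U k 𝕜 (k - j) ∈ algUV k 𝕜 :=
    mul_mem (natCast_mem _ _) (U_mem_algUV _)
  refine ⟨C (k : Poly k 𝕜) * X * (polyU k 𝕜 /ₘ X ^ (k - j + 1)) + C (j * U k 𝕜 (k - j)), ?_, ?_⟩
  · rw [residual₁_field₂ hk hj, pullback_shiftedResidual polyU_mem_coeffsIn polyU_mem_coeffsIn hl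
      pullback_C_W₁]
  · rw [residual₂_field₂ hk hj, pullback_shiftedResidual polyV_mem_coeffsIn polyU_mem_coeffsIn hl
      pullback_C_W₁]

lemma field₃_mem_algLiftable {j : ℕ} (hj : j < k) : field₃ k 𝕜 j ∈ algLiftable k 𝕜 := by
  have hl : (k : Poly k 𝕜) * V k 𝕜 (k - j) ∈ algUV k 𝕜 :=
    mul_mem (natCast_mem _ _) (V_mem_algUV _)
  refine ⟨C (k : Poly k 𝕜) * X * (polyV k 𝕜 /ₘ X ^ (k - j + 1)) + C (k * V k 𝕜 (k - j)), ?_, ?_⟩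
  · rw [residual₁_field₃ hj, pullback_shiftedResidual polyU_mem_coeffsIn polyV_mem_coeffsIn hl
      pullback_C_W₂]
  · rw [residual₂_field₃ hj, pullback_shiftedResidual polyV_mem_coeffsIn polyV_mem_coeffsIn hl
      pullback_C_W₂]

lemma eulerField_mem_genSpan : eulerField k 𝕜 ∈ genSpan k 𝕜 :=
  Submodule.subset_span (Set.mem_insert _ _)

lemma family_mem_genSpan (i : Fin 3) {j : ℕ} (hj : 1 ≤ j) (hjk : j < k) :
    family k 𝕜 i j ∈ genSpan k 𝕜 :=
  Submodule.subset_span (Set.mem_insert_of_mem _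
    ⟨(i, j), by simpa using ⟨hj, Nat.le_pred_of_lt hjk⟩, rfl⟩)

lemma genSpan_le_algLiftable (hk : 2 ≤ k) : genSpan k 𝕜 ≤ algLiftable k 𝕜 := by
  refine Submodule.span_le.2 (Set.insert_subset (eulerField_mem_algLiftable hk) ?_)
  rintro _ ⟨⟨i, j⟩, hij, rfl⟩
  obtain ⟨hj, hjk⟩ : 1 ≤ j ∧ j ≤ k - 1 := by simpa using hij
  fin_cases i
  · exact field₁_mem_algLiftable hk hj
  · exact field₂_mem_algLiftable hk (by omega)
  · exact field₃_mem_algLiftable (by omega)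

lemma exists_eq_of_mem_genSpan {ξ : PolyField k 𝕜} (hξ : ξ ∈ genSpan k 𝕜) :
    ∃ (gₑ : Poly k 𝕜) (g : Fin 3 → ℕ → Poly k 𝕜), ξ = gₑ • eulerField k 𝕜 +
      ∑ i : Fin 3, ∑ j ∈ Finset.Icc 1 (k - 1), g i j • family k 𝕜 i j := by
  obtain ⟨gₑ, ζ, hζ, rfl⟩ := Submodule.mem_span_insert.1 hξ
  obtain ⟨c, rfl⟩ := (Submodule.mem_span_image_finset_iff_exists_fun _).1 hζ
  refine ⟨gₑ, fun i j => if h : (i, j) ∈ Finset.univ ×ˢ Finset.Icc 1 (k - 1) then c ⟨_, h⟩ else 0,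
    ?_⟩
  rw [← Finset.sum_product', ← Finset.sum_attach (Finset.univ ×ˢ _)]
  exact congrArg _ (Finset.sum_congr rfl fun p _ => by simp)

end AlgebraicallyLiftable

section Reduction

variable (k : ℕ) (𝕜 : Type*) [RCLike 𝕜]

/-- The polynomials in the coordinates `U_i`, `V_i` and `W₁`. -/
def algUVW₁ : Subalgebra 𝕜 (Poly k 𝕜) := MvPolynomial.supported 𝕜 {.inr (.inr 1)}ᶜ

variable {k 𝕜}

lemma algUV_le_algUVW₁ : algUV k 𝕜 ≤ algUVW₁ k 𝕜 :=
  MvPolynomial.supported_mono (Set.compl_subset_compl.2 (Set.singleton_subset_iff.2 ⟨1, rfl⟩))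

lemma adjoin_algUV_union : Algebra.adjoin 𝕜 (algUV k 𝕜 ∪ {W₁ k 𝕜, W₂ k 𝕜}) = ⊤ := by
  rw [eq_top_iff, ← MvPolynomial.adjoin_range_X]
  refine Algebra.adjoin_mono ?_
  rintro _ ⟨i | i | i, rfl⟩
  · exact .inl (MvPolynomial.X_mem_supported.2 (by simp))
  · exact .inl (MvPolynomial.X_mem_supported.2 (by simp))
  · fin_cases i
    · exact .inr (.inl rfl)
    · exact .inr (.inr rfl)

lemma adjoin_algUVW₁_union : Algebra.adjoin 𝕜 (algUVW₁ k 𝕜 ∪ {W₂ k 𝕜}) = ⊤ := by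
  rw [eq_top_iff, ← MvPolynomial.adjoin_range_X]
  refine Algebra.adjoin_mono ?_
  rintro _ ⟨t, rfl⟩
  by_cases ht : t = .inr (.inr 1)
  · exact .inr (ht ▸ rfl)
  · exact .inl (MvPolynomial.X_mem_supported.2 ht)

lemma smul_sub_shiftedResidual_mem_coeffsIn {F S : Type*} [CommRing F] [CommRing S] [Algebra F S]
    {T : Subalgebra F S} {f g : S[X]} {l : S} (hf : f ∈ coeffsIn T) (hg : g ∈ coeffsIn T)
    (hl : l ∈ T) (k : ℕ) (w : S) (j : ℕ) :
    w • (C (k : S) * ((X * derivative f) /ₘ X ^ (k - j + 1))) - shiftedResidual k g w l j f ∈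
      coeffsIn T := by
  have hXf := mul_mem X_mem_coeffsIn (derivative_mem_coeffsIn hf)
  have hshift := divByMonic_X_pow_mem_coeffsIn hXf (k - j + 1)
  have heq : w • (C (k : S) * ((X * derivative f) /ₘ X ^ (k - j + 1))) -
      shiftedResidual k g w l j f =
        C (k : S) * (g * ((X * derivative f) /ₘ X ^ (k - j + 1)) -
          X * derivative f * (g /ₘ X ^ (k - j + 1))) - C l * derivative f := by
    rw [shiftedResidual_eq, smul_eq_C_mul, C_mul]
    ring
  rw [heq]
  exact sub_mem (mul_mem (C_mem_coeffsIn (natCast_mem _ _)) (sub_mem (mul_mem hg hshift)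
    (mul_mem hXf (divByMonic_X_pow_mem_coeffsIn hg _))))
    (mul_mem (C_mem_coeffsIn hl) (derivative_mem_coeffsIn hf))

lemma exists_smul_sub_residual₁_mem (hk : 2 ≤ k) {w : Poly k 𝕜}
    (hw : w ∈ ({W₁ k 𝕜, W₂ k 𝕜} : Set (Poly k 𝕜))) {d : ℕ} (hd : d < k - 1) :
    ∃ H ∈ coeffsIn (algUV k 𝕜), H.natDegree ≤ d ∧
      (∃ c : 𝕜ˣ, H.coeff d = algebraMap 𝕜 (Poly k 𝕜) c) ∧
      ∃ m ∈ (genSpan k 𝕜).map (residual₁ k 𝕜), w • H - m ∈ coeffsIn (algUV k 𝕜) := by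
  have hk₀ : (k : 𝕜) ≠ 0 := Nat.cast_ne_zero.2 (by omega)
  have hXP := mul_mem X_mem_coeffsIn
    (derivative_mem_coeffsIn (polyU_mem_coeffsIn (k := k) (𝕜 := 𝕜)))
  refine ⟨C (k : Poly k 𝕜) * ((X * derivative (polyU k 𝕜)) /ₘ X ^ (k - (d + 1) + 1)),
    mul_mem (C_mem_coeffsIn (natCast_mem _ _)) (divByMonic_X_pow_mem_coeffsIn hXP _),
    (natDegree_C_mul_le _ _).trans (natDegree_divByMonic_X_pow_le
      ((natDegree_X_mul_derivative_le _).trans (natDegree_polyU.trans_le (by omega)))),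
    ⟨Units.mk0 (k * k) (mul_ne_zero hk₀ hk₀), ?_⟩, ?_⟩
  · rw [coeff_C_mul, coeff_divByMonic_X_pow, show k - (d + 1) + 1 + d = k by omega,
      coeff_X_mul_derivative, coeff_polyU, U_self, mul_one, Units.val_mk0, map_mul, map_natCast]
  · obtain rfl | rfl := hw
    · refine ⟨_, ⟨_, family_mem_genSpan 1 d.succ_pos (by omega), residual₁_field₂ hk (by omega)⟩,
        smul_sub_shiftedResidual_mem_coeffsIn polyU_mem_coeffsIn polyU_mem_coeffsIn ?_ k _ _⟩
      exact mul_mem (natCast_mem _ _) (U_mem_algUV _)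
    · refine ⟨_, ⟨_, family_mem_genSpan 2 d.succ_pos (by omega), residual₁_field₃ (by omega)⟩,
        smul_sub_shiftedResidual_mem_coeffsIn polyU_mem_coeffsIn polyV_mem_coeffsIn ?_ k _ _⟩
      exact mul_mem (natCast_mem _ _) (V_mem_algUV _)

lemma exists_residual₁_sub_mem (hk : 2 ≤ k) (ξ : PolyField k 𝕜) :
    ∃ ζ ∈ genSpan k 𝕜, residual₁ k 𝕜 (ξ - ζ) ∈ coeffsIn (algUV k 𝕜) := by
  obtain ⟨_, ⟨ζ, hζ, rfl⟩, h⟩ := exists_sub_mem_coeffsIn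
    (M := (genSpan k 𝕜).map (residual₁ k 𝕜)) adjoin_algUV_union
    (Submodule.map_le_iff_le_comap.2 fun ζ _ => residual_mem_degreeLT _ _ ζ)
    (fun _ hw _ hd => exists_smul_sub_residual₁_mem hk hw (by omega)) (residual_mem_degreeLT _ _ ξ)
  exact ⟨ζ, hζ, by rwa [map_sub]⟩

lemma polyU_divByMonic_X_pow_self : polyU k 𝕜 /ₘ X ^ k = 1 := by
  ext n
  rw [coeff_divByMonic_X_pow, coeff_polyU, coeff_one]
  obtain rfl | hn := n.eq_zero_or_pos
  · rw [if_pos rfl, add_zero, U_self]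
  · rw [if_neg (by omega), U_of_lt (by omega)]

lemma X_mul_derivative_polyU_divByMonic_X_pow_self :
    (X * derivative (polyU k 𝕜)) /ₘ X ^ k = C (k : Poly k 𝕜) := by
  ext n
  rw [coeff_divByMonic_X_pow, coeff_X_mul_derivative, coeff_polyU, coeff_C]
  obtain rfl | hn := n.eq_zero_or_pos
  · rw [if_pos rfl, add_zero, U_self, mul_one]
  · rw [if_neg (by omega), U_of_lt (by omega), mul_zero]

lemma X_mul_derivative_polyV_divByMonic_X_pow_self (hk : 0 < k) :
    (X * derivative (polyV k 𝕜)) /ₘ X ^ k = 0 := by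
  ext n
  rw [coeff_divByMonic_X_pow, coeff_X_mul_derivative, coeff_polyV, V_of_lt (by omega), mul_zero,
    coeff_zero]

lemma residual₁_smul_eulerField_sub_field₂ (hk : 2 ≤ k) :
    residual₁ k 𝕜 ((k : Poly k 𝕜) • eulerField k 𝕜 - field₂ k 𝕜 1) = 0 := by
  rw [map_sub, map_smul, residual₁_eulerField hk, residual₁_field₂ hk (by omega),
    shiftedResidual, Nat.sub_add_cancel (by omega), polyU_divByMonic_X_pow_self,
    X_mul_derivative_polyU_divByMonic_X_pow_self, U_pred hk, smul_eq_C_mul]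
  simp only [mul_zero, C_0]
  ring

lemma residual₂_smul_eulerField_sub_field₂ (hk : 2 ≤ k) :
    residual₂ k 𝕜 ((k : Poly k 𝕜) • eulerField k 𝕜 - field₂ k 𝕜 1) =
      C (k * k : Poly k 𝕜) * (C (W₂ k 𝕜) - polyV k 𝕜) := by
  rw [map_sub, map_smul, residual₂_eulerField hk, residual₂_field₂ hk (by omega),
    shiftedResidual, Nat.sub_add_cancel (by omega), polyU_divByMonic_X_pow_self,
    X_mul_derivative_polyV_divByMonic_X_pow_self (by omega), U_pred hk, smul_eq_C_mul]
  simp only [mul_zero, C_0, C_mul]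
  ring

lemma residual₁_field₁_sub_smul_eulerField (j : ℕ) :
    residual₁ k 𝕜 (field₁ k 𝕜 j - ((k - j) * U k 𝕜 j) • eulerField k 𝕜) = 0 := by
  rw [map_sub, map_smul, residual₁_field₁, sub_self]

lemma residual₂_field₁_sub_smul_eulerField (hk : 2 ≤ k) {j : ℕ} (hj : 1 ≤ j) :
    residual₂ k 𝕜 (field₁ k 𝕜 j - ((k - j) * U k 𝕜 j) • eulerField k 𝕜) =
      (C (W₂ k 𝕜) - polyV k 𝕜) * (C (k : Poly k 𝕜) * (polyU k 𝕜 /ₘ X ^ j) -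
        C ((j + k * (k - j)) * U k 𝕜 j)) -
      C (k : Poly k 𝕜) * (C (W₁ k 𝕜) - polyU k 𝕜) * (polyV k 𝕜 /ₘ X ^ j) := by
  rw [map_sub, map_smul, residual₂_field₁ hk hj, residual₂_eulerField hk, smul_eq_C_mul]
  simp only [C_mul, C_add]
  ring

lemma exists_smul_sub_residual₂_mem (hk : 2 ≤ k) {d : ℕ} (hd : d < k) :
    ∃ H ∈ coeffsIn (algUVW₁ k 𝕜), H.natDegree ≤ d ∧
      (∃ c : 𝕜ˣ, H.coeff d = algebraMap 𝕜 (Poly k 𝕜) c) ∧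
      ∃ m ∈ (genSpan k 𝕜 ⊓ LinearMap.ker (residual₁ k 𝕜)).map (residual₂ k 𝕜),
        W₂ k 𝕜 • H - m ∈ coeffsIn (algUVW₁ k 𝕜) := by
  have hk₀ : (k : 𝕜) ≠ 0 := Nat.cast_ne_zero.2 (by omega)
  have hP := coeffsIn_mono algUV_le_algUVW₁ (polyU_mem_coeffsIn (k := k) (𝕜 := 𝕜))
  have hQ := coeffsIn_mono algUV_le_algUVW₁ (polyV_mem_coeffsIn (k := k) (𝕜 := 𝕜))
  have hcast (n : ℕ) : (n : Poly k 𝕜) ∈ algUVW₁ k 𝕜 := natCast_mem _ n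
  obtain rfl | hd₀ := d.eq_zero_or_pos
  · refine ⟨C (k * k), C_mem_coeffsIn (mul_mem (hcast k) (hcast k)), (natDegree_C _).le,
      ⟨Units.mk0 (k * k) (mul_ne_zero hk₀ hk₀), ?_⟩, _,
      ⟨_, ⟨sub_mem (Submodule.smul_mem _ _ eulerField_mem_genSpan)
        (family_mem_genSpan 1 le_rfl hk), residual₁_smul_eulerField_sub_field₂ hk⟩,
        residual₂_smul_eulerField_sub_field₂ hk⟩, ?_⟩
    · rw [coeff_C_zero, Units.val_mk0, map_mul, map_natCast]
    · rw [smul_eq_C_mul, mul_sub, mul_comm (C (W₂ k 𝕜)), sub_sub_cancel]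
      exact mul_mem (C_mem_coeffsIn (mul_mem (hcast k) (hcast k))) hQ
  · have hU : (((k - d : ℕ) : Poly k 𝕜) + k * (k - (k - d : ℕ))) * U k 𝕜 (k - d) ∈ algUVW₁ k 𝕜 :=
      mul_mem (add_mem (hcast _) (mul_mem (hcast k) (sub_mem (hcast k) (hcast _))))
        (algUV_le_algUVW₁ (U_mem_algUV _))
    have hPj := mul_mem (C_mem_coeffsIn (hcast k)) (divByMonic_X_pow_mem_coeffsIn hP (k - d))
    refine ⟨C (k : Poly k 𝕜) * (polyU k 𝕜 /ₘ X ^ (k - d)) - C _,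
      sub_mem hPj (C_mem_coeffsIn hU), ?_, ⟨Units.mk0 k hk₀, ?_⟩, _,
      ⟨_, ⟨sub_mem (family_mem_genSpan 0 (by omega) (Nat.sub_lt (by omega) hd₀))
        (Submodule.smul_mem _ _ eulerField_mem_genSpan), residual₁_field₁_sub_smul_eulerField _⟩,
        residual₂_field₁_sub_smul_eulerField hk (by omega)⟩, ?_⟩
    · rw [natDegree_sub_C]
      exact (natDegree_C_mul_le _ _).trans (natDegree_divByMonic_X_pow_le
        (natDegree_polyU.trans_le (by omega)))
    · rw [coeff_sub, coeff_C_mul, coeff_divByMonic_X_pow, coeff_polyU, coeff_C, if_neg hd₀.ne',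
        show k - d + d = k by omega, U_self, mul_one, sub_zero, Units.val_mk0, map_natCast]
    · rw [smul_eq_C_mul, sub_mul, sub_sub, sub_sub_cancel]
      refine add_mem (mul_mem hQ (sub_mem hPj (C_mem_coeffsIn hU))) (mul_mem (mul_mem
        (C_mem_coeffsIn (hcast k)) (sub_mem (C_mem_coeffsIn ?_) hP))
        (divByMonic_X_pow_mem_coeffsIn hQ _))
      exact MvPolynomial.X_mem_supported.2 (by simp)

lemma exists_residual₂_sub_mem (hk : 2 ≤ k) (ξ : PolyField k 𝕜) :
    ∃ ζ ∈ genSpan k 𝕜, residual₁ k 𝕜 ζ = 0 ∧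
      residual₂ k 𝕜 (ξ - ζ) ∈ coeffsIn (algUVW₁ k 𝕜) := by
  obtain ⟨_, ⟨ζ, ⟨hζ, hζ₁⟩, rfl⟩, h⟩ := exists_sub_mem_coeffsIn
    (M := (genSpan k 𝕜 ⊓ LinearMap.ker (residual₁ k 𝕜)).map (residual₂ k 𝕜))
    adjoin_algUVW₁_union
    (Submodule.map_le_iff_le_comap.2 fun ζ _ => residual_mem_degreeLT _ _ ζ)
    (by
      rintro _ rfl d hd
      exact exists_smul_sub_residual₂_mem hk (by omega)) (residual_mem_degreeLT _ _ ξ)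
  exact ⟨ζ, hζ, hζ₁, by rwa [map_sub]⟩

end Reduction

section AlgebraicGeneration

lemma eq_zero_of_sum_comp_mul_X_pow_eq_zero {R : Type*} [CommRing R] [IsDomain R] {P : R[X]}
    {N : ℕ} (hPN : P.natDegree = N) {q : ℕ → R[X]}
    (h : ∑ i ∈ Finset.range N, (q i).comp P * X ^ i = 0) {i : ℕ} (hi : i < N) : q i = 0 := by
  subst hPN
  have hdeg (i : ℕ) (hi : (q i).comp P * X ^ i ≠ 0) :
      ((q i).comp P * X ^ i).natDegree = (q i).natDegree * P.natDegree + i := by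
    rw [natDegree_mul_X_pow _ (left_ne_zero_of_mul hi), natDegree_comp]
  have hdisj : Set.Pairwise {i | i ∈ Finset.range P.natDegree ∧ (q i).comp P * X ^ i ≠ 0}
      (Function.onFun (· ≠ ·) (degree ∘ fun i => (q i).comp P * X ^ i)) := by
    rintro i ⟨hi, hi₀⟩ j ⟨hj, hj₀⟩ hij heq
    have hmod := congrArg (· % P.natDegree) (natDegree_eq_natDegree heq)
    simp only [hdeg i hi₀, hdeg j hj₀, Nat.mul_add_mod_self_right,
      Nat.mod_eq_of_lt (Finset.mem_range.1 hi), Nat.mod_eq_of_lt (Finset.mem_range.1 hj)] at hmod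
    exact hij hmod
  have hterm : (q i).comp P * X ^ i = 0 := by
    have hsup := degree_sum_eq_of_disjoint _ _ hdisj
    rw [h, degree_zero, eq_comm, Finset.sup_eq_bot_iff] at hsup
    exact degree_eq_bot.1 (hsup i (Finset.mem_range.2 hi))
  obtain hq | ⟨-, hP⟩ := comp_eq_zero_iff.1
    ((mul_eq_zero_iff_right (pow_ne_zero i X_ne_zero)).1 hterm)
  · exact hq
  · rw [hP, natDegree_C] at hi
    omega

variable {k : ℕ} {𝕜 : Type*} [RCLike 𝕜]

lemma exists_pullback_C_eq_comp {s : Poly k 𝕜} (hs : s ∈ algUVW₁ k 𝕜) :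
    ∃ q : (Poly k 𝕜)[X], pullback k 𝕜 (C s) = q.comp (polyU k 𝕜) ∧ q.eval (W₁ k 𝕜) = s := by
  induction hs using Algebra.adjoin_induction with
  | mem s hs =>
    obtain ⟨t, ht, rfl⟩ := hs
    obtain i | i | i := t
    · exact ⟨C _, by rw [C_comp, pullback_C, MvPolynomial.aeval_X, crossCapPoly], eval_C⟩
    · exact ⟨C _, by rw [C_comp, pullback_C, MvPolynomial.aeval_X, crossCapPoly], eval_C⟩
    · fin_cases i
      · exact ⟨X, by rw [X_comp]; exact pullback_C_W₁, eval_X⟩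
      · exact absurd rfl ht
  | algebraMap r => exact ⟨C _, by rw [C_comp, pullback_C_of_mem (algebraMap_mem _ r)], eval_C⟩
  | add s t _ _ hs ht =>
    obtain ⟨p, hp, hps⟩ := hs
    obtain ⟨q, hq, hqt⟩ := ht
    exact ⟨p + q, by rw [C_add, map_add, hp, hq, add_comp], by rw [eval_add, hps, hqt]⟩
  | mul s t _ _ hs ht =>
    obtain ⟨p, hp, hps⟩ := hs
    obtain ⟨q, hq, hqt⟩ := ht
    exact ⟨p * q, by rw [C_mul, map_mul, hp, hq, mul_comp], by rw [eval_mul, hps, hqt]⟩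

lemma eq_zero_of_pullback_eq_zero {f : (Poly k 𝕜)[X]} (hf : f ∈ coeffsIn (algUVW₁ k 𝕜))
    (hdeg : f.degree < k) (h : pullback k 𝕜 f = 0) : f = 0 := by
  obtain rfl | hf₀ := eq_or_ne f 0
  · rfl
  choose q hq hqf using fun n => exists_pullback_C_eq_comp (mem_coeffsIn.1 hf n)
  have hsum : f = ∑ i ∈ Finset.range k, C (f.coeff i) * X ^ i :=
    as_sum_range_C_mul_X_pow' f ((natDegree_lt_iff_degree_lt hf₀).2 hdeg)
  have hq₀ : ∀ n < k, q n = 0 := fun n hn => by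
    have hsum₀ := (congrArg (pullback k 𝕜) hsum).symm.trans h
    simp only [map_sum, map_mul, map_pow, pullback_X, hq] at hsum₀
    exact eq_zero_of_sum_comp_mul_X_pow_eq_zero natDegree_polyU hsum₀ hn
  rw [hsum]
  exact Finset.sum_eq_zero fun i hi => by
    rw [← hqf i, hq₀ i (Finset.mem_range.1 hi), eval_zero, C_0, zero_mul]

lemma degree_derivative_polyU (hk : 2 ≤ k) :
    (derivative (polyU k 𝕜)).degree = (k - 1 : ℕ) := by
  rw [degree_derivative (by rw [natDegree_polyU]; omega), natDegree_polyU]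

lemma derivative_polyU_ne_zero (hk : 2 ≤ k) : derivative (polyU k 𝕜) ≠ 0 :=
  ne_zero_of_coe_le_degree (degree_derivative_polyU hk).ge

lemma eq_zero_of_residual_eq_zero {ξ : PolyField k 𝕜} (h₁ : residual₁ k 𝕜 ξ = 0)
    (h₂ : residual₂ k 𝕜 ξ = 0) : ξ = 0 := by
  have hC₁ : ξ (.inr (.inr 0)) = 0 :=
    (coeff_residual_zero _ _ ξ).symm.trans (congrArg (coeff · 0) h₁)
  have hC₂ : ξ (.inr (.inr 1)) = 0 :=
    (coeff_residual_zero _ _ ξ).symm.trans (congrArg (coeff · 0) h₂)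
  have hA (i : Fin (k - 2)) : ξ (.inl i) = 0 :=
    neg_eq_zero.1 ((coeff_residual_succ _ _ ξ i).symm.trans (congrArg (coeff · (i + 1)) h₁))
  have hB (i : Fin (k - 1)) : ξ (.inr (.inl i)) = 0 :=
    neg_eq_zero.1 ((coeff_residual_succ _ _ ξ i).symm.trans (congrArg (coeff · (i + 1)) h₂))
  funext t
  obtain i | i | i := t
  · exact hA i
  · exact hB i
  · fin_cases i
    · exact hC₁
    · exact hC₂

theorem algLiftable_le_genSpan (hk : 2 ≤ k) : algLiftable k 𝕜 ≤ genSpan k 𝕜 := by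
  intro ξ hξ
  obtain ⟨ζ, hζ, hζ₁⟩ := exists_residual₁_sub_mem hk ξ
  obtain ⟨ζ', hζ', hζ'₁, hζ'₂⟩ := exists_residual₂_sub_mem hk (ξ - ζ)
  have hmem : ζ + ζ' ∈ genSpan k 𝕜 := add_mem hζ hζ'
  obtain ⟨h, h₁, h₂⟩ := sub_mem hξ (genSpan_le_algLiftable hk hmem)
  rw [← sub_sub] at h₁ h₂
  have hres₁ : residual₁ k 𝕜 (ξ - ζ - ζ') = 0 := by
    have hfixed : pullback k 𝕜 (residual₁ k 𝕜 (ξ - ζ - ζ')) = residual₁ k 𝕜 (ξ - ζ - ζ') := by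
      rw [map_sub (residual₁ k 𝕜), hζ'₁, sub_zero, pullback_eq_self hζ₁]
    refine eq_zero_of_dvd_of_degree_lt ⟨h, hfixed.symm.trans h₁⟩ ?_
    rw [degree_derivative_polyU hk]
    exact (mem_degreeLT.1 (residual_mem_degreeLT _ _ _)).trans_eq (by congr 1; omega)
  have hh : h = 0 := by
    rw [hres₁, map_zero, eq_comm] at h₁
    exact (mul_eq_zero.1 h₁).resolve_left (derivative_polyU_ne_zero hk)
  have hres₂ : residual₂ k 𝕜 (ξ - ζ - ζ') = 0 := by
    refine eq_zero_of_pullback_eq_zero hζ'₂ ?_ (by rw [h₂, hh, mul_zero])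
    exact (mem_degreeLT.1 (residual_mem_degreeLT _ _ _)).trans_eq (by congr 1; omega)
  rw [sub_sub] at hres₁ hres₂
  rwa [sub_eq_zero.1 (eq_zero_of_residual_eq_zero hres₁ hres₂)]

end AlgebraicGeneration

section LocalVanishing

variable {F ι : Type*} [NontriviallyNormedField F]

lemma eq_of_eventually_eval_eq {f g : MvPolynomial ι F} {x : ι → F}
    (h : ∀ᶠ z in 𝓝 x, MvPolynomial.eval z f = MvPolynomial.eval z g) : f = g := by
  rw [nhds_pi] at h
  obtain ⟨I, -, t, ht, hI⟩ := Filter.mem_pi.1 h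
  exact MvPolynomial.funext_set t (fun i => infinite_of_mem_nhds (x i) (ht i))
    fun z hz => hI fun i _ => hz i trivial

lemma dvd_sub_bind₁_X_sub {R : Type*} [CommRing R] (D : MvPolynomial ι R)
    (g : ι → MvPolynomial ι R) (f : MvPolynomial ι R) :
    D ∣ f - MvPolynomial.bind₁ (fun i => MvPolynomial.X i - g i * D) f := by
  rw [← Ideal.mem_span_singleton, ← Ideal.Quotient.eq]
  refine DFunLike.congr_fun (F := MvPolynomial ι R →ₐ[R] _) (f := Ideal.Quotient.mkₐ R _)
    (g := (Ideal.Quotient.mkₐ R _).comp (MvPolynomial.bind₁ _))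
    (MvPolynomial.algHom_ext fun i => ?_) f
  rw [AlgHom.comp_apply, MvPolynomial.bind₁_X_right, map_sub, Ideal.Quotient.mkₐ_eq_mk,
    Ideal.Quotient.eq_zero_iff_mem.2 (Ideal.mem_span_singleton.2 (dvd_mul_left D (g i))), sub_zero]

/-- If `D` grows with unit speed in direction `e`, then `z ↦ z - D z • e` is a projection to the
zero set of `D`. -/
lemma dvd_of_eventually_eval_eq_zero {D f : MvPolynomial ι F} {e x : ι → F}
    (he : ∀ z (c : F), MvPolynomial.eval (z + c • e) D = MvPolynomial.eval z D + c)
    (hx : MvPolynomial.eval x D = 0)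
    (h : ∀ᶠ z in 𝓝 x, MvPolynomial.eval z D = 0 → MvPolynomial.eval z f = 0) : D ∣ f := by
  let proj (z : ι → F) : ι → F := z + (-MvPolynomial.eval z D) • e
  have hproj_mem (z : ι → F) : MvPolynomial.eval (proj z) D = 0 := by rw [he, add_neg_cancel]
  have hproj : Tendsto proj (𝓝 x) (𝓝 x) := by
    have hcont : Continuous proj :=
      continuous_id.add ((MvPolynomial.continuous_eval D).neg.smul continuous_const)
    simpa [proj, hx] using hcont.tendsto x
  let σ : ι → MvPolynomial ι F := fun i => MvPolynomial.X i - MvPolynomial.C (e i) * D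
  have hσ (z : ι → F) : MvPolynomial.eval z ∘ σ = proj z := by
    ext i
    simp only [σ, proj, Function.comp_apply, map_sub, map_mul, MvPolynomial.eval_X,
      MvPolynomial.eval_C, Pi.add_apply, Pi.smul_apply, smul_eq_mul]
    ring
  have hzero : MvPolynomial.bind₁ σ f = 0 := by
    refine eq_of_eventually_eval_eq (x := x) ?_
    filter_upwards [hproj.eventually h] with z hz
    rw [map_zero, ← hz (hproj_mem z), ← hσ z]
    exact (MvPolynomial.eval_assoc σ z f).symm
  have hdvd := dvd_sub_bind₁_X_sub D (fun i => MvPolynomial.C (e i)) f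
  rwa [hzero, sub_zero] at hdvd

end LocalVanishing

section PolynomialLift

/-- The evaluation of a polynomial in `y = X` over `F[x_i]` at the point `z`, whose coordinate
`none` is the value of `y`. -/
def evalAt {F ι : Type*} [CommRing F] (z : Option ι → F) : (MvPolynomial ι F)[X] →+* F :=
  (MvPolynomial.eval z).comp (MvPolynomial.optionEquivLeft F ι).symm.toRingHom

section EvalAt

variable {F ι : Type*} [CommRing F]

@[simp] lemma evalAt_X (z : Option ι → F) : evalAt z X = z none := by
  simp [evalAt]

@[simp] lemma evalAt_C (z : Option ι → F) (s : MvPolynomial ι F) :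
    evalAt z (C s) = MvPolynomial.eval (fun i => z (some i)) s := by
  refine DFunLike.congr_fun (f := (evalAt z).comp C) (MvPolynomial.ringHom_ext ?_ ?_) s <;>
    simp [evalAt]

end EvalAt

section LocalEvalAt

variable {F ι : Type*} [NontriviallyNormedField F] {f g : (MvPolynomial ι F)[X]}
  {x : Option ι → F}

lemma eq_of_eventually_evalAt_eq (h : ∀ᶠ z in 𝓝 x, evalAt z f = evalAt z g) : f = g :=
  (MvPolynomial.optionEquivLeft F ι).symm.injective (eq_of_eventually_eval_eq h)

lemma dvd_of_eventually_evalAt_eq_zero {e : Option ι → F}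
    (he : ∀ z (c : F), evalAt (z + c • e) g = evalAt z g + c) (hx : evalAt x g = 0)
    (h : ∀ᶠ z in 𝓝 x, evalAt z g = 0 → evalAt z f = 0) : g ∣ f :=
  (map_dvd_iff (MvPolynomial.optionEquivLeft F ι).symm).1
    (dvd_of_eventually_eval_eq_zero he hx h)

end LocalEvalAt

lemma hasFDerivAt_sum_mul_pow {F σ : Type*} [NontriviallyNormedField F] [Finite σ] {N : ℕ}
    (a : Fin N → σ) (b : σ) (x : σ → F) :
    HasFDerivAt (fun x : σ → F => ∑ i : Fin N, x (a i) * x b ^ ((i : ℕ) + 1))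
      ((∑ i : Fin N, x (a i) * (((i : ℕ) + 1) * x b ^ (i : ℕ))) •
          ContinuousLinearMap.proj (R := F) b +
        ∑ i : Fin N, x b ^ ((i : ℕ) + 1) • ContinuousLinearMap.proj (R := F) (a i)) x := by
  have := Fintype.ofFinite σ
  have h := HasFDerivAt.fun_sum (u := Finset.univ) fun (i : Fin N) _ =>
    (hasFDerivAt_apply (𝕜 := F) (a i) x).mul ((hasFDerivAt_apply (𝕜 := F) b x).pow ((i : ℕ) + 1))
  refine h.congr_fderiv ?_
  rw [Finset.sum_add_distrib]
  congr 1
  ext v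
  simp [Finset.sum_mul, mul_assoc]

variable {k : ℕ} {𝕜 : Type*} [RCLike 𝕜]

/-- The point of the source of the cross cap mapping with the `u`-, `v`- and `y`-coordinates of a
point of the graph; the remaining coordinates are ignored. -/
def sourcePoint (z : Option (Tgt k) → 𝕜) : Src k → 𝕜
  | .inl i => z (some (.inl i))
  | .inr (.inl i) => z (some (.inr (.inl i)))
  | .inr (.inr ()) => z none

lemma continuous_sourcePoint : Continuous (sourcePoint (k := k) (𝕜 := 𝕜)) :=
  continuous_pi fun t => by
    obtain _ | _ | _ := t <;> exact continuous_apply _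

lemma evalAt_crossCapPoly (z : Option (Tgt k) → 𝕜) (t : Tgt k) :
    evalAt z (crossCapPoly k 𝕜 t) = crossCap k 𝕜 (sourcePoint z) t := by
  obtain i | i | i := t
  · simp [crossCapPoly, crossCap, sourcePoint]
  · simp [crossCapPoly, crossCap, sourcePoint]
  · fin_cases i <;> simp [crossCapPoly, crossCap, sourcePoint, polyU, polyV]

lemma evalAt_pullback_C (z : Option (Tgt k) → 𝕜) (s : Poly k 𝕜) :
    evalAt z (pullback k 𝕜 (C s)) = MvPolynomial.eval (crossCap k 𝕜 (sourcePoint z)) s := by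
  rw [pullback_C]
  refine DFunLike.congr_fun (f := (evalAt z).comp (MvPolynomial.aeval (crossCapPoly k 𝕜)).toRingHom)
    (MvPolynomial.ringHom_ext (fun r => ?_) fun t => ?_) s
  · simp [Polynomial.algebraMap_apply]
  · simp [evalAt_crossCapPoly]

lemma evalAt_pullback_residual {N : ℕ} (c : Tgt k) (a : Fin N → Tgt k) (ξ : PolyField k 𝕜)
    (z : Option (Tgt k) → 𝕜) :
    evalAt z (pullback k 𝕜 (residual c a ξ)) = ξ.toFun (crossCap k 𝕜 (sourcePoint z)) c -
      ∑ i, ξ.toFun (crossCap k 𝕜 (sourcePoint z)) (a i) * z none ^ ((i : ℕ) + 1) := by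
  simp only [residual_apply, map_sub, map_sum, map_mul, map_pow, pullback_X, evalAt_X,
    evalAt_pullback_C, PolyField.toFun]

lemma evalAt_derivative_polyU (z : Option (Tgt k) → 𝕜) :
    evalAt z (derivative (polyU k 𝕜)) = k * z none ^ (k - 1) +
      ∑ i : Fin (k - 2), z (some (.inl i)) * (((i : ℕ) + 1) * z none ^ (i : ℕ)) := by
  rw [polyU, derivative_add, derivative_X_pow]
  simp

lemma evalAt_derivative_polyV (z : Option (Tgt k) → 𝕜) :
    evalAt z (derivative (polyV k 𝕜)) =
      ∑ i : Fin (k - 1), z (some (.inr (.inl i))) * (((i : ℕ) + 1) * z none ^ (i : ℕ)) := by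
  simp [polyV]

lemma differentiableAt_crossCap_apply (x : Src k → 𝕜) (t : Tgt k) :
    DifferentiableAt 𝕜 (fun x => crossCap k 𝕜 x t) x := by
  obtain i | i | i := t
  · exact (hasFDerivAt_apply _ x).differentiableAt
  · exact (hasFDerivAt_apply _ x).differentiableAt
  · fin_cases i <;> simp only [crossCap] <;> fun_prop

lemma fderiv_crossCap_apply {x : Src k → 𝕜} {t : Tgt k} {L : (Src k → 𝕜) →L[𝕜] 𝕜}
    (h : HasFDerivAt (fun x => crossCap k 𝕜 x t) L x) (v : Src k → 𝕜) :
    fderiv 𝕜 (crossCap k 𝕜) x v t = L v := by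
  have hfderiv := fderiv_pi (𝕜 := 𝕜) (differentiableAt_crossCap_apply x)
  change fderiv 𝕜 (fun x t => crossCap k 𝕜 x t) x v t = _
  rw [hfderiv, ContinuousLinearMap.pi_apply, h.fderiv]

lemma fderiv_crossCap_inl (x v : Src k → 𝕜) (i : Fin (k - 2)) :
    fderiv 𝕜 (crossCap k 𝕜) x v (.inl i) = v (.inl i) :=
  fderiv_crossCap_apply (t := .inl i) (hasFDerivAt_apply (.inl i) x) v

lemma fderiv_crossCap_inr_inl (x v : Src k → 𝕜) (i : Fin (k - 1)) :
    fderiv 𝕜 (crossCap k 𝕜) x v (.inr (.inl i)) = v (.inr (.inl i)) :=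
  fderiv_crossCap_apply (t := .inr (.inl i)) (hasFDerivAt_apply (.inr (.inl i)) x) v

lemma fderiv_crossCap_W₁ (z : Option (Tgt k) → 𝕜) (v : Src k → 𝕜) :
    fderiv 𝕜 (crossCap k 𝕜) (sourcePoint z) v (.inr (.inr 0)) =
      evalAt z (derivative (polyU k 𝕜)) * v (.inr (.inr ())) +
        ∑ i : Fin (k - 2), v (.inl i) * z none ^ ((i : ℕ) + 1) := by
  rw [fderiv_crossCap_apply (((hasFDerivAt_apply (.inr (.inr ())) (sourcePoint z)).pow k).add
    (hasFDerivAt_sum_mul_pow .inl (.inr (.inr ())) (sourcePoint z))), evalAt_derivative_polyU]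
  simp [sourcePoint, add_mul _ _ (v _), add_assoc, mul_comm (v (.inl _))]

lemma fderiv_crossCap_W₂ (z : Option (Tgt k) → 𝕜) (v : Src k → 𝕜) :
    fderiv 𝕜 (crossCap k 𝕜) (sourcePoint z) v (.inr (.inr 1)) =
      evalAt z (derivative (polyV k 𝕜)) * v (.inr (.inr ())) +
        ∑ i : Fin (k - 1), v (.inr (.inl i)) * z none ^ ((i : ℕ) + 1) := by
  rw [fderiv_crossCap_apply (hasFDerivAt_sum_mul_pow (fun i => .inr (.inl i)) (.inr (.inr ()))
    (sourcePoint z)), evalAt_derivative_polyV]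
  simp [sourcePoint, mul_comm]

lemma evalAt_pullback_residual_of_fderiv_eq {ξ : PolyField k 𝕜} {z : Option (Tgt k) → 𝕜}
    {v : Src k → 𝕜} (h : fderiv 𝕜 (crossCap k 𝕜) (sourcePoint z) v =
      ξ.toFun (crossCap k 𝕜 (sourcePoint z))) :
    evalAt z (pullback k 𝕜 (residual₁ k 𝕜 ξ)) =
        evalAt z (derivative (polyU k 𝕜)) * v (.inr (.inr ())) ∧
      evalAt z (pullback k 𝕜 (residual₂ k 𝕜 ξ)) =
        evalAt z (derivative (polyV k 𝕜)) * v (.inr (.inr ())) := by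
  constructor <;> rw [evalAt_pullback_residual, ← h]
  · simp only [fderiv_crossCap_W₁, fderiv_crossCap_inl, add_sub_cancel_right]
  · simp only [fderiv_crossCap_W₂, fderiv_crossCap_inr_inl, add_sub_cancel_right]

lemma evalAt_zero_derivative_polyU (hk : 2 ≤ k) :
    evalAt (0 : Option (Tgt k) → 𝕜) (derivative (polyU k 𝕜)) = 0 := by
  rw [evalAt_derivative_polyU]
  simp [show k - 1 ≠ 0 by omega]

/-- The direction is that of `u_1`, except for `k = 2`, where the polynomial is `2 y`. -/
lemma exists_evalAt_add_smul_derivative_polyU (hk : 2 ≤ k) :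
    ∃ e : Option (Tgt k) → 𝕜, ∀ z (c : 𝕜), evalAt (z + c • e) (derivative (polyU k 𝕜)) =
      evalAt z (derivative (polyU k 𝕜)) + c := by
  obtain rfl | hk := hk.eq_or_lt
  · refine ⟨Pi.single none 2⁻¹, fun z c => ?_⟩
    simp only [evalAt_derivative_polyU]
    simp [mul_add, mul_left_comm _ c]
  · refine ⟨Pi.single (some (.inl ⟨0, by omega⟩)) 1, fun z c => ?_⟩
    simp only [evalAt_derivative_polyU]
    simp [add_mul _ (ite _ _ _), Finset.sum_add_distrib, add_assoc, Pi.single_apply]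

theorem mem_algLiftable_of_eventually_exists_fderiv_eq (hk : 2 ≤ k) {ξ : PolyField k 𝕜}
    (hξ : ∀ᶠ x in 𝓝 0, ∃ v, fderiv 𝕜 (crossCap k 𝕜) x v = ξ.toFun (crossCap k 𝕜 x)) :
    ξ ∈ algLiftable k 𝕜 := by
  have htendsto : Tendsto (sourcePoint (k := k) (𝕜 := 𝕜)) (𝓝 0) (𝓝 0) := by
    convert continuous_sourcePoint.tendsto _
    ext (i | i | i) <;> rfl
  have hlocal := htendsto.eventually hξ
  obtain ⟨e, he⟩ := exists_evalAt_add_smul_derivative_polyU (𝕜 := 𝕜) hk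
  obtain ⟨h, h₁⟩ : derivative (polyU k 𝕜) ∣ pullback k 𝕜 (residual₁ k 𝕜 ξ) := by
    refine dvd_of_eventually_evalAt_eq_zero he (evalAt_zero_derivative_polyU hk) ?_
    filter_upwards [hlocal] with z ⟨v, hv⟩ hz
    rw [(evalAt_pullback_residual_of_fderiv_eq hv).1, hz, zero_mul]
  refine ⟨h, h₁, mul_left_cancel₀ (derivative_polyU_ne_zero hk) ?_⟩
  rw [mul_left_comm, ← h₁]
  refine eq_of_eventually_evalAt_eq (x := 0) ?_
  filter_upwards [hlocal] with z ⟨v, hv⟩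
  obtain ⟨hv₁, hv₂⟩ := evalAt_pullback_residual_of_fderiv_eq hv
  rw [map_mul, map_mul, hv₁, hv₂]
  ring

end PolynomialLift

end CrossCap

end

theorem mainTheorem2_general {𝕜 : Type*} [RCLike 𝕜] (k : ℕ) (hk : 2 ≤ k)
    (ξ : CrossCap.PolyField k 𝕜)
    (hξ : ∀ᶠ x in 𝓝 0, ∃ v, fderiv 𝕜 (CrossCap.crossCap k 𝕜) x v =
      ξ.toFun (CrossCap.crossCap k 𝕜 x)) :
    ∃ (gₑ : CrossCap.Poly k 𝕜) (g : Fin 3 → ℕ → CrossCap.Poly k 𝕜),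
      ξ = gₑ • CrossCap.eulerField k 𝕜 +
        ∑ i : Fin 3, ∑ j ∈ Finset.Icc 1 (k - 1), g i j • CrossCap.family k 𝕜 i j :=
  CrossCap.exists_eq_of_mem_genSpan <| CrossCap.algLiftable_le_genSpan hk <|
    CrossCap.mem_algLiftable_of_eventually_exists_fderiv_eq hk hξ

theorem mainTheorem2 {𝕜 : Type*} [RCLike 𝕜] (k : ℕ) (hk : 2 ≤ k)
    (ξ : CrossCap.PolyField k 𝕜)
    (hξ : CrossCap.Liftable (CrossCap.crossCap k 𝕜) ξ.toFun) :
    ∃ (gₑ : CrossCap.Poly k 𝕜) (g : Fin 3 → ℕ → CrossCap.Poly k 𝕜),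
      ξ = gₑ • CrossCap.eulerField k 𝕜 +
        ∑ i : Fin 3, ∑ j ∈ Finset.Icc 1 (k - 1), g i j • CrossCap.family k 𝕜 i j := by
  obtain ⟨N, η, hN, h0, -, hη⟩ := hξ
  exact mainTheorem2_general k hk ξ
    (by filter_upwards [hN.mem_nhds h0] with x hx using ⟨η x, hη x hx⟩)
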